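/- Let $d\ge 1$ be an integer and $\alpha\ge 0$ a real number. For $K\subset\mathbb R^d$ and $\delta>0$ write $K_\delta=K+B(0,\delta)$, and let $|\cdot|$ denote Lebesgue measure. Let $\mathcal K_d(\alpha)$ be the class of compact sets $K\subset\mathbb R^d$ of Hausdorff dimension $\dim K=\alpha$ for which $K_\delta$ is a $\delta$-discrete $\alpha$-set in the sense of Katz and Tao, uniformly in $\delta$: there is a constant $C(K)$ such that $$|K_\delta\cap B(x,r)|\le C(K)\,(r/\delta)^\alpha\,\delta^d\qquad\text{for all } 0<\delta\le 1,\ x\in\mathbb R^d,\ r\ge\delta.$$ Put $D(K)=\{(k_1,k_2)\in K\times K: |k_2-k_1|=1\}\subset\mathbb R^{2d}$ and $g_d(\alpha)=\sup\{\dim D(K): K\in\mathcal K_d(\alpha)\}$, where $\dim$ is Hausdorff dimension. Let $\dim_M$ denote upper Minkowski dimension, $\dim_M A=\limsup_{\delta\to0+}\bigl(n-\log|A_\delta|/\log\delta\bigr)$ for $A\subset\mathbb R^n$ (with $\dim_M\emptyset=-\infty$). Then: 1. If $(d+1)/2\le\alpha\le d$, then $g_d(\alpha)=2\alpha-1$;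 moreover $\dim_M D(K)\le 2\alpha-1$ for every $K\in\mathcal K_d(\alpha)$. 2. If $\alpha\le(d+1)/2$, then $g_d(\alpha)\le\alpha+(d-1)/2$; moreover $\dim_M D(K)\le\alpha+(d-1)/2$ for every $K\in\mathcal K_d(\alpha)$. -/

import Mathlib

open scoped ENNReal Topology

noncomputable section

namespace UnitDistance

/-- The set `D(K)` of ordered pairs of points of `K` at distance one. The ambient space `ℝ^d × ℝ^d`
carries the max of the two Euclidean distances, which is bi-Lipschitz equivalent to the Euclidean
distance of `ℝ^(2d)`, so Hausdorff and Minkowski dimensions are the usual ones. -/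
def unitPairs {d : ℕ} (K : Set (EuclideanSpace ℝ (Fin d))) :
    Set (EuclideanSpace ℝ (Fin d) × EuclideanSpace ℝ (Fin d)) :=
  {p | p.1 ∈ K ∧ p.2 ∈ K ∧ ‖p.2 - p.1‖ = 1}

/-- The `δ`-neighbourhoods `K_δ = K + B(0, δ)` are `δ`-discrete `α`-sets in the sense of Katz and
Tao, with one constant for all scales: `|K_δ ∩ B(x, r)| ≤ C (r / δ)^α δ^d` for all `x` and `r ≥ δ`.
(For bounded `K` and `α ≥ 0` the scales `δ > 1` would add nothing.) -/
def IsDiscreteAlphaSet {d : ℕ} (α : ℝ) (K : Set (EuclideanSpace ℝ (Fin d))) : Prop :=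
  ∃ C : ℝ, ∀ δ : ℝ, 0 < δ → δ ≤ 1 → ∀ (x : EuclideanSpace ℝ (Fin d)) (r : ℝ), δ ≤ r →
    MeasureTheory.volume (Metric.thickening δ K ∩ Metric.ball x r) ≤
      ENNReal.ofReal (C * (r / δ) ^ α * δ ^ d)

/-- The compact sets of Hausdorff dimension `α` satisfying the regularity condition. -/
structure IsRegularSet {d : ℕ} (α : ℝ) (K : Set (EuclideanSpace ℝ (Fin d))) : Prop where
  isCompact : IsCompact K
  dimH_eq : dimH K = ENNReal.ofReal α
  isDiscreteAlphaSet : IsDiscreteAlphaSet α K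

/-- `g_d(α)`: the supremum of the Hausdorff dimension of `D(K)` over all regular compact sets
`K ⊆ ℝ^d` of dimension `α`. -/
def g (d : ℕ) (α : ℝ) : ℝ≥0∞ :=
  sSup {s | ∃ K : Set (EuclideanSpace ℝ (Fin d)), IsRegularSet α K ∧ s = dimH (unitPairs K)}

/-- The upper Minkowski dimension `limsup_{δ → 0+} (n - log |A_δ| / log δ)` of a subset `A` of an
`n`-dimensional space, where `A_δ` is the open `δ`-neighbourhood of `A`. The empty set has
dimension `-∞`, as `ENNReal.log 0 = ⊥`. -/
def upperMinkowskiDim {E : Type*} [NormedAddCommGroup E] [NormedSpace ℝ E]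
    [MeasureTheory.MeasureSpace E] (A : Set E) : EReal :=
  Filter.limsup (fun δ : ℝ => ((Module.finrank ℝ E : ℝ) : EReal) -
    ENNReal.log (MeasureTheory.volume (Metric.thickening δ A)) / (Real.log δ : EReal)) (𝓝[>] 0)

end UnitDistance

end

/-! The indicator of the annulus `||x| - 1| ≲ δ` has Fourier transform `O(δ |ξ|^{-(d-1)/2})`: up to
powers of `|ξ|` it is a difference of Bessel functions, and these solve a perturbed harmonic
oscillator, whose energy stays bounded. The volume of the `δ`-neighbourhood of `D(K)` is at most
the mass which the difference measure of Lebesgue measure on `K_δ` gives to such an annulus. This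
mass is bounded on the Fourier side after smoothing by a Gaussian of width `δ`: the multiplier
`|ξ|^{-(d-1)/2}` is dominated by a dyadic sum of Gaussians of widths `2^{-j}`, and each of these
contributes the energy of `K_δ` at scale `2^{-j}`, which the Katz–Tao condition controls. Summing
the geometric series gives `dim_M D(K) ≤ max (2α - 1) (α + (d-1)/2)`, and the Hausdorff dimension
is no larger.

For the sharpness, let `T ⊆ [0, 1]` be an Ahlfors regular set of dimension `γ` with
`α = 1 + (d-1) γ` and let `K = [0, 2] × T ^ (d-1)`, where `T` has small enough diameter. Any two
points of `T ^ (d-1)` are then the last coordinates of a pair in `D(K)`, for which the first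
coordinate of the first point may be any number in `[0, 1]`, so a Lipschitz image of `D(K)`
contains `[0, 1] × T ^ (d-1) × T ^ (d-1)`, a set of dimension `1 + 2 (d-1) γ = 2α - 1`.
-/

noncomputable section

namespace UnitDistance

open MeasureTheory

/-! ### Bessel integrals -/

/-- The oscillatory integral `∫_0^π exp (i s cos θ) g θ dθ`; taking a general amplitude `g` makes
the class of these integrals closed under differentiation in `s`. -/
def waveIntegral (g : ℝ → ℂ) (s : ℝ) : ℂ :=
  ∫ θ in (0 : ℝ)..Real.pi, Complex.exp (Complex.I * (s * Real.cos θ : ℝ)) * g θ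

theorem hasDerivAt_waveIntegral {g : ℝ → ℂ} (hg : Continuous g) (s : ℝ) :
    HasDerivAt (waveIntegral g)
      (waveIntegral (fun θ => Complex.I * Real.cos θ * g θ) s) s := by
  unfold waveIntegral
  refine (intervalIntegral.hasDerivAt_integral_of_dominated_loc_of_deriv_le
    (bound := fun θ => ‖g θ‖) (s := Set.univ) Filter.univ_mem
    (F := fun s θ => Complex.exp (Complex.I * (s * Real.cos θ : ℝ)) * g θ)
    (F' := fun s θ => Complex.exp (Complex.I * (s * Real.cos θ : ℝ)) *
      (Complex.I * Real.cos θ * g θ)) ?_ ?_ ?_ ?_ ?_ ?_).2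
  · exact Filter.Eventually.of_forall fun x => (by fun_prop : Continuous _).aestronglyMeasurable
  · exact (by fun_prop : Continuous _).intervalIntegrable _ _
  · exact (by fun_prop : Continuous _).aestronglyMeasurable
  · refine Filter.Eventually.of_forall fun θ _ x _ => ?_
    rw [norm_mul, norm_mul, norm_mul, Complex.norm_exp_I_mul_ofReal, Complex.norm_I, one_mul,
      one_mul, Complex.norm_real]
    exact mul_le_of_le_one_left (norm_nonneg _) (Real.abs_cos_le_one θ)
  · exact (by fun_prop : Continuous _).intervalIntegrable _ _
  · refine Filter.Eventually.of_forall fun θ _ x _ => ?_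
    have h1 : HasDerivAt (fun x : ℝ => Complex.I * ((x * Real.cos θ : ℝ) : ℂ))
        (Complex.I * ((1 * Real.cos θ : ℝ) : ℂ)) x :=
      (((hasDerivAt_id x).mul_const (Real.cos θ)).ofReal_comp).const_mul Complex.I
    convert! (h1.cexp).mul_const (g θ) using 1
    push_cast; ring

/-- The integral `∫_0^π exp (i s cos θ) sin θ ^ k dθ`, which is a constant multiple of
`J_{k/2}(s) / s^{k/2}` for the Bessel function `J_{k/2}`. -/
def besselIntegral (k : ℕ) : ℝ → ℂ := waveIntegral fun θ => (Real.sin θ : ℂ) ^ k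

/-- The derivative of `besselIntegral k`, in integral form. -/
def besselIntegralDeriv (k : ℕ) : ℝ → ℂ :=
  waveIntegral fun θ => Complex.I * Real.cos θ * (Real.sin θ : ℂ) ^ k

theorem hasDerivAt_besselIntegral (k : ℕ) (s : ℝ) :
    HasDerivAt (besselIntegral k) (besselIntegralDeriv k s) s :=
  hasDerivAt_waveIntegral (by fun_prop) s

theorem hasDerivAt_besselIntegralDeriv (k : ℕ) (s : ℝ) :
    HasDerivAt (besselIntegralDeriv k) (besselIntegral (k + 2) s - besselIntegral k s) s := by
  convert! hasDerivAt_waveIntegral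
    (g := fun θ => Complex.I * Real.cos θ * (Real.sin θ : ℂ) ^ k) (by fun_prop) s using 1
  unfold besselIntegral waveIntegral
  rw [← intervalIntegral.integral_sub]
  · refine intervalIntegral.integral_congr fun θ _ => ?_
    have h : (Real.sin θ : ℂ) ^ 2 + (Real.cos θ : ℂ) ^ 2 = 1 := by
      exact_mod_cast Real.sin_sq_add_cos_sq θ
    have h' : (Real.sin θ : ℂ) ^ 2 = 1 - (Real.cos θ : ℂ) ^ 2 := by linear_combination h
    simp only [pow_add, h']
    linear_combination (-(Complex.exp (Complex.I * (s * Real.cos θ : ℝ)) * (Real.cos θ : ℂ) ^ 2 *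
      (Real.sin θ : ℂ) ^ k)) * Complex.I_sq
  · exact (by fun_prop : Continuous _).intervalIntegrable _ _
  · exact (by fun_prop : Continuous _).intervalIntegrable _ _

theorem besselIntegralDeriv_eq (k : ℕ) (s : ℝ) :
    (k + 1 : ℂ) * besselIntegralDeriv k s = -(s * besselIntegral (k + 2) s) := by
  have hd : ∀ θ : ℝ, HasDerivAt
      (fun θ : ℝ => Complex.exp (Complex.I * (s * Real.cos θ : ℝ)) * (Real.sin θ : ℂ) ^ (k + 1))
      (-(Complex.I * s) * (Complex.exp (Complex.I * (s * Real.cos θ : ℝ)) *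
          (Real.sin θ : ℂ) ^ (k + 2)) + -(Complex.I * (k + 1)) *
        (Complex.exp (Complex.I * (s * Real.cos θ : ℝ)) *
          (Complex.I * Real.cos θ * (Real.sin θ : ℂ) ^ k))) θ := by
    intro θ
    have h1 : HasDerivAt (fun θ : ℝ => Complex.I * ((s * Real.cos θ : ℝ) : ℂ))
        (Complex.I * ((s * (-Real.sin θ) : ℝ) : ℂ)) θ :=
      (((Real.hasDerivAt_cos θ).const_mul s).ofReal_comp).const_mul Complex.I
    have h2 : HasDerivAt (fun θ : ℝ => (Real.sin θ : ℂ) ^ (k + 1))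
        (((k + 1 : ℕ) : ℂ) * (Real.sin θ : ℂ) ^ k * (Real.cos θ : ℂ)) θ :=
      ((Real.hasDerivAt_sin θ).ofReal_comp).pow (k + 1)
    convert! h1.cexp.mul h2 using 1
    push_cast
    linear_combination (-(Complex.exp (Complex.I * (s * Complex.cos θ)) * (k + 1) *
      Complex.cos θ * (Complex.sin θ) ^ k)) * Complex.I_sq
  have hi := intervalIntegral.integral_eq_sub_of_hasDerivAt (a := 0) (b := Real.pi)
    (fun θ _ => hd θ) ((by fun_prop : Continuous _).intervalIntegrable _ _)
  rw [intervalIntegral.integral_add ((by fun_prop : Continuous _).intervalIntegrable _ _)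
    ((by fun_prop : Continuous _).intervalIntegrable _ _),
    intervalIntegral.integral_const_mul, intervalIntegral.integral_const_mul] at hi
  simp only [Real.sin_pi, Real.sin_zero, Complex.ofReal_zero, ne_eq, Nat.succ_ne_zero,
    not_false_eq_true, zero_pow, mul_zero, sub_self] at hi
  change -(Complex.I * s) * besselIntegral (k + 2) s +
    -(Complex.I * (k + 1)) * besselIntegralDeriv k s = 0 at hi
  linear_combination (Complex.I) * hi + ((k + 1 : ℂ) * besselIntegralDeriv k s +
    (s * besselIntegral (k + 2) s)) * Complex.I_sq

theorem norm_besselIntegral_le (k : ℕ) (s : ℝ) : ‖besselIntegral k s‖ ≤ Real.pi := by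
  have := intervalIntegral.norm_integral_le_of_norm_le_const (a := 0) (b := Real.pi) (C := 1)
    (f := fun θ => Complex.exp (Complex.I * (s * Real.cos θ : ℝ)) * (Real.sin θ : ℂ) ^ k) ?_
  · rwa [one_mul, sub_zero, abs_of_pos Real.pi_pos] at this
  · intro θ _
    rw [norm_mul, Complex.norm_exp_I_mul_ofReal, one_mul, norm_pow, Complex.norm_real]
    exact pow_le_one₀ (norm_nonneg _) (Real.abs_sin_le_one θ)

theorem hasDerivAt_pow_mul_besselIntegral (k : ℕ) (s : ℝ) :
    HasDerivAt (fun s : ℝ => (s : ℂ) ^ (k + 2) * besselIntegral (k + 2) s)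
      ((k + 1) * (s : ℂ) ^ (k + 1) * besselIntegral k s) s := by
  have heq : (fun s : ℝ => (s : ℂ) ^ (k + 2) * besselIntegral (k + 2) s) =
      fun s : ℝ => -(k + 1 : ℂ) * ((s : ℂ) ^ (k + 1) * besselIntegralDeriv k s) := by
    funext s
    linear_combination ((s : ℂ) ^ (k + 1)) * besselIntegralDeriv_eq k s
  rw [heq]
  have h1 : HasDerivAt (fun s : ℝ => (s : ℂ) ^ (k + 1)) (((k + 1 : ℕ) : ℂ) * (s : ℂ) ^ k) s := by
    convert! ((hasDerivAt_id s).ofReal_comp).pow (k + 1) using 1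
    simp
  convert! (h1.mul (hasDerivAt_besselIntegralDeriv k s)).const_mul (-(k + 1 : ℂ)) using 1
  push_cast
  linear_combination ((k + 1 : ℂ) * (s : ℂ) ^ k) * besselIntegralDeriv_eq k s

theorem antitoneOn_mul_exp_div {E E' : ℝ → ℝ} {c : ℝ} (hE : ∀ s, 0 < s → HasDerivAt E (E' s) s)
    (hE' : ∀ s, 0 < s → E' s ≤ c / s ^ 2 * E s) :
    AntitoneOn (fun s => E s * Real.exp (c / s)) (Set.Ioi 0) := by
  have hderiv : ∀ s, 0 < s → HasDerivAt (fun s => E s * Real.exp (c / s))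
      (E' s * Real.exp (c / s) + E s * (Real.exp (c / s) * (-c / s ^ 2))) s := by
    intro s hs
    refine (hE s hs).mul ?_
    convert! ((hasDerivAt_inv hs.ne').const_mul c).exp using 1
    rw [div_eq_mul_inv]; ring
  refine antitoneOn_of_deriv_nonpos (convex_Ioi 0)
    (fun s hs => (hderiv s hs).continuousAt.continuousWithinAt) ?_ ?_
  · intro s hs
    rw [interior_Ioi] at hs
    exact (hderiv s hs).differentiableAt.differentiableWithinAt
  · intro s hs
    rw [interior_Ioi] at hs
    rw [(hderiv s hs).deriv]
    have hfactor : E' s * Real.exp (c / s) + E s * (Real.exp (c / s) * (-c / s ^ 2)) =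
        Real.exp (c / s) * (E' s - c / s ^ 2 * E s) := by ring
    rw [hfactor]
    exact mul_nonpos_of_nonneg_of_nonpos (Real.exp_pos _).le (sub_nonpos.2 (hE' s hs))

theorem exists_norm_le_of_hasDerivAt_perturbed_oscillator {F : Type*} [NormedAddCommGroup F]
    [InnerProductSpace ℝ F] {u w : ℝ → F} (q : ℝ) (hu : ∀ s, 0 < s → HasDerivAt u (w s) s)
    (hw : ∀ s, 0 < s → HasDerivAt w ((q / s ^ 2 - 1) • u s) s) :
    ∃ C, ∀ s, 1 ≤ s → ‖u s‖ ≤ C := by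
  set E : ℝ → ℝ := fun s => ‖u s‖ ^ 2 + ‖w s‖ ^ 2
  have henergy : ∀ s, 0 < s → HasDerivAt E (q / s ^ 2 * (2 * inner ℝ (u s) (w s))) s := by
    intro s hs
    convert! (hu s hs).norm_sq.add (hw s hs).norm_sq using 1
    rw [inner_smul_right, real_inner_comm]
    ring
  have hgrowth : ∀ s, 0 < s → q / s ^ 2 * (2 * inner ℝ (u s) (w s)) ≤ |q| / s ^ 2 * E s := by
    intro s _
    have hinner : |2 * inner ℝ (u s) (w s)| ≤ E s := by
      rw [abs_mul, abs_two]
      have := abs_real_inner_le_norm (u s) (w s)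
      linarith [two_mul_le_add_sq ‖u s‖ ‖w s‖]
    calc q / s ^ 2 * (2 * inner ℝ (u s) (w s))
        ≤ |q / s ^ 2| * |2 * inner ℝ (u s) (w s)| := by rw [← abs_mul]; exact le_abs_self _
      _ ≤ |q| / s ^ 2 * E s := by rw [abs_div, abs_sq]; gcongr
  refine ⟨Real.sqrt (E 1 * Real.exp |q|), fun s hs => Real.le_sqrt_of_sq_le ?_⟩
  have hs0 : 0 < s := one_pos.trans_le hs
  have hE0 : 0 ≤ E s := by positivity
  calc ‖u s‖ ^ 2 ≤ E s := le_add_of_nonneg_right (sq_nonneg _)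
    _ ≤ E s * Real.exp (|q| / s) :=
      le_mul_of_one_le_right hE0 (Real.one_le_exp (by positivity))
    _ ≤ E 1 * Real.exp |q| := by
      simpa only [div_one] using
        antitoneOn_mul_exp_div henergy hgrowth (Set.mem_Ioi.2 one_pos) hs0 hs

/-- The derivative of `s ^ ((k + 1) / 2) • besselIntegral k s`, the normalization for which the
Bessel equation has no first order term. -/
def normalizedBesselDeriv (k : ℕ) (s : ℝ) : ℂ :=
  s ^ ((k + 1 : ℝ) / 2) • besselIntegralDeriv k s +
    ((k + 1 : ℝ) / 2 * s ^ ((k + 1 : ℝ) / 2 - 1)) • besselIntegral k s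

theorem hasDerivAt_rpow_smul_besselIntegral (k : ℕ) {s : ℝ} (hs : 0 < s) :
    HasDerivAt (fun s : ℝ => s ^ ((k + 1 : ℝ) / 2) • besselIntegral k s)
      (normalizedBesselDeriv k s) s :=
  (Real.hasDerivAt_rpow_const (Or.inl hs.ne')).smul (hasDerivAt_besselIntegral k s)

theorem hasDerivAt_normalizedBesselDeriv (k : ℕ) {s : ℝ} (hs : 0 < s) :
    HasDerivAt (normalizedBesselDeriv k) (((k + 1 : ℝ) / 2 * ((k + 1 : ℝ) / 2 - 1) / s ^ 2 - 1) •
      (s ^ ((k + 1 : ℝ) / 2) • besselIntegral k s)) s := by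
  have hpow : ∀ a : ℝ, HasDerivAt (fun s : ℝ => s ^ a) (a * s ^ (a - 1)) s := fun a =>
    Real.hasDerivAt_rpow_const (Or.inl hs.ne')
  convert! ((hpow _).smul (hasDerivAt_besselIntegralDeriv k s)).add
    (((hpow _).const_mul _).smul (hasDerivAt_besselIntegral k s)) using 1
  have hs' : (s : ℂ) ≠ 0 := by exact_mod_cast hs.ne'
  have hrec : besselIntegral (k + 2) s = -((k + 1 : ℂ) / s) * besselIntegralDeriv k s := by
    field_simp
    linear_combination besselIntegralDeriv_eq k s
  rw [Real.rpow_sub_one hs.ne' (_ - 1), Real.rpow_sub_one hs.ne', hrec]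
  simp only [Complex.real_smul]
  push_cast
  field_simp
  ring

theorem exists_norm_besselIntegral_le_rpow (k : ℕ) :
    ∃ C, 0 ≤ C ∧ ∀ s : ℝ, 0 < s → ‖besselIntegral k s‖ ≤ C * s ^ (-((k + 1 : ℝ) / 2)) := by
  obtain ⟨C, hC⟩ := exists_norm_le_of_hasDerivAt_perturbed_oscillator _
    (fun _ hs => hasDerivAt_rpow_smul_besselIntegral k hs)
    (fun _ hs => hasDerivAt_normalizedBesselDeriv k hs)
  refine ⟨max C Real.pi, le_max_of_le_right Real.pi_pos.le, fun s hs => ?_⟩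
  rw [Real.rpow_neg hs.le, ← div_eq_mul_inv, le_div_iff₀ (by positivity)]
  rcases le_total 1 s with h | h
  · have hdecay := hC s h
    rw [norm_smul, Real.norm_of_nonneg (by positivity), mul_comm] at hdecay
    exact hdecay.trans (le_max_left _ _)
  · calc ‖besselIntegral k s‖ * s ^ ((k + 1 : ℝ) / 2) ≤ Real.pi * 1 :=
          mul_le_mul (norm_besselIntegral_le k s)
            (Real.rpow_le_one hs.le h (by positivity)) (by positivity) Real.pi_pos.le
      _ ≤ max C Real.pi := by rw [mul_one]; exact le_max_right _ _

/-! ### The Fourier transform of an annulus -/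

/-- The identification of `ℝ × ℝ^n` with `ℝ^(n+1)`, the first factor being the coordinate `0`; it
is used to integrate over slices. -/
def euclideanCons (n : ℕ) (z : ℝ × EuclideanSpace ℝ (Fin n)) : EuclideanSpace ℝ (Fin (n + 1)) :=
  WithLp.toLp 2 (Fin.insertNth 0 z.1 (WithLp.ofLp z.2))

theorem measurePreserving_euclideanCons (n : ℕ) :
    MeasurePreserving (euclideanCons n) volume volume := by
  have h1 : MeasurePreserving
      (Prod.map id (WithLp.ofLp : EuclideanSpace ℝ (Fin n) → Fin n → ℝ)) (volume.prod volume)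
      ((volume : Measure ℝ).prod volume) :=
    (MeasurePreserving.id volume).prod (PiLp.volume_preserving_ofLp (Fin n))
  have h2 := (volume_preserving_piFinSuccAbove (fun _ : Fin (n + 1) => ℝ) 0).symm
  exact ((PiLp.volume_preserving_toLp (Fin (n + 1))).comp h2).comp h1

theorem norm_sq_euclideanCons (n : ℕ) (z : ℝ × EuclideanSpace ℝ (Fin n)) :
    ‖euclideanCons n z‖ ^ 2 = z.1 ^ 2 + ‖z.2‖ ^ 2 := by
  rw [EuclideanSpace.norm_sq_eq, Fin.sum_univ_succ, EuclideanSpace.norm_sq_eq]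
  simp [euclideanCons]

theorem euclideanCons_zero (n : ℕ) (z : ℝ × EuclideanSpace ℝ (Fin n)) :
    euclideanCons n z 0 = z.1 := by
  simp [euclideanCons]

theorem euclideanCons_mem_ball_iff {n : ℕ} {R : ℝ} (hR : 0 ≤ R) {t : ℝ}
    {y : EuclideanSpace ℝ (Fin n)} :
    euclideanCons n (t, y) ∈ Metric.ball (0 : EuclideanSpace ℝ (Fin (n + 1))) R ↔
      t ∈ Set.Ioo (-R) R ∧
        y ∈ Metric.ball (0 : EuclideanSpace ℝ (Fin n)) (Real.sqrt (R ^ 2 - t ^ 2)) := by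
  rw [mem_ball_zero_iff, mem_ball_zero_iff, Real.lt_sqrt (norm_nonneg _), Set.mem_Ioo, ← abs_lt,
    ← abs_of_nonneg hR, ← sq_lt_sq₀ (norm_nonneg _) (abs_nonneg R),
    norm_sq_euclideanCons n (t, y), ← sq_lt_sq, sq_abs]
  constructor
  · intro h
    exact ⟨by linarith [sq_nonneg ‖y‖], by linarith⟩
  · rintro ⟨-, h⟩
    linarith

theorem integrableOn_ball_of_continuous {X G : Type*} [PseudoMetricSpace X] [ProperSpace X]
    [MeasurableSpace X] [OpensMeasurableSpace X] {μ : Measure X} [IsFiniteMeasureOnCompacts μ]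
    [NormedAddCommGroup G] {f : X → G} (hf : Continuous f) (x : X) (R : ℝ) :
    IntegrableOn f (Metric.ball x R) μ :=
  (hf.locallyIntegrable.integrableOn_isCompact (isCompact_closedBall x R)).mono_set
    Metric.ball_subset_closedBall

theorem volume_real_ball {d : ℕ} {r : ℝ} (hr : 0 < r) :
    volume.real (Metric.ball (0 : EuclideanSpace ℝ (Fin d)) r) =
      r ^ d * volume.real (Metric.ball (0 : EuclideanSpace ℝ (Fin d)) 1) := by
  rw [measureReal_def, Measure.addHaar_ball_of_pos _ _ hr, finrank_euclideanSpace_fin,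
    ENNReal.toReal_mul, ENNReal.toReal_ofReal (by positivity), measureReal_def]

section Slicing

variable {G : Type*} [NormedAddCommGroup G] [NormedSpace ℝ G]

theorem integral_eq_integral_integral_euclideanCons (n : ℕ)
    {F : EuclideanSpace ℝ (Fin (n + 1)) → G} (hF : Integrable F) :
    ∫ x, F x = ∫ t, ∫ y, F (euclideanCons n (t, y)) := by
  have hmp := measurePreserving_euclideanCons n
  have hF' : Integrable (fun z => F (euclideanCons n z)) (volume.prod volume) :=
    (hmp.integrable_comp hF.aestronglyMeasurable).2 hF
  rw [← integral_prod _ hF', ← Measure.volume_eq_prod]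
  nth_rw 1 [← hmp.map_eq]
  refine integral_map hmp.measurable.aemeasurable ?_
  rw [hmp.map_eq]
  exact hF.aestronglyMeasurable

theorem setIntegral_ball_comp_coord [CompleteSpace G] (n : ℕ) {R : ℝ} (hR : 0 ≤ R) {f : ℝ → G}
    (hf : Continuous f) :
    ∫ x in Metric.ball (0 : EuclideanSpace ℝ (Fin (n + 1))) R, f (x 0) =
      volume.real (Metric.ball (0 : EuclideanSpace ℝ (Fin n)) 1) •
        ∫ t in -R..R, Real.sqrt (R ^ 2 - t ^ 2) ^ n • f t := by
  have hint : Integrable ((Metric.ball (0 : EuclideanSpace ℝ (Fin (n + 1))) R).indicator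
      fun x => f (x 0)) :=
    (integrable_indicator_iff measurableSet_ball).2
      (integrableOn_ball_of_continuous (by fun_prop) 0 R)
  rw [← integral_indicator measurableSet_ball,
    integral_eq_integral_integral_euclideanCons n hint,
    intervalIntegral.integral_of_le (by linarith), integral_Ioc_eq_integral_Ioo, ← integral_smul,
    ← integral_indicator measurableSet_Ioo]
  congr 1 with t
  by_cases ht : t ∈ Set.Ioo (-R) R
  · have hslice : ∀ y, (Metric.ball (0 : EuclideanSpace ℝ (Fin (n + 1))) R).indicator
        (fun x => f (x 0)) (euclideanCons n (t, y)) =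
        (Metric.ball 0 (Real.sqrt (R ^ 2 - t ^ 2))).indicator (fun _ => f t) y := by
      intro y
      classical
      simp only [Set.indicator_apply, euclideanCons_mem_ball_iff hR, ht, true_and,
        euclideanCons_zero]
    have hsqrt : 0 < Real.sqrt (R ^ 2 - t ^ 2) :=
      Real.sqrt_pos.2 (sub_pos.2 (sq_lt_sq' ht.1 ht.2))
    simp only [hslice]
    rw [integral_indicator measurableSet_ball, setIntegral_const, Set.indicator_of_mem ht,
      volume_real_ball hsqrt, smul_smul, mul_comm]
  · classical
    simp only [Set.indicator_apply, euclideanCons_mem_ball_iff hR, ht, false_and, if_false,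
      integral_zero]

theorem intervalIntegral_sqrt_pow_smul (n : ℕ) {R : ℝ} (hR : 0 ≤ R) {f : ℝ → G}
    (hf : Continuous f) :
    ∫ t in -R..R, Real.sqrt (R ^ 2 - t ^ 2) ^ n • f t =
      R ^ (n + 1) • ∫ θ in (0 : ℝ)..Real.pi, Real.sin θ ^ (n + 1) • f (R * Real.cos θ) := by
  have hsubst := intervalIntegral.integral_deriv_smul_comp (a := 0) (b := Real.pi)
    (f := fun θ => R * Real.cos θ) (f' := fun θ => R * (-Real.sin θ))
    (g := fun t => Real.sqrt (R ^ 2 - t ^ 2) ^ n • f t)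
    (fun θ _ => (Real.hasDerivAt_cos θ).const_mul R) (by fun_prop) (by fun_prop)
  simp only [Real.cos_zero, mul_one, Real.cos_pi, mul_neg] at hsubst
  rw [intervalIntegral.integral_symm, ← hsubst, ← intervalIntegral.integral_neg,
    ← intervalIntegral.integral_smul]
  refine intervalIntegral.integral_congr fun θ hθ => ?_
  rw [Set.uIcc_of_le Real.pi_pos.le] at hθ
  have hsqrt : Real.sqrt (R ^ 2 - (R * Real.cos θ) ^ 2) = R * Real.sin θ := by
    rw [show R ^ 2 - (R * Real.cos θ) ^ 2 = (R * Real.sin θ) ^ 2 by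
      rw [mul_pow, mul_pow, Real.sin_sq]; ring]
    exact Real.sqrt_sq (mul_nonneg hR (Real.sin_nonneg_of_mem_Icc hθ))
  simp only [Function.comp_apply, hsqrt, smul_smul]
  rw [← neg_smul]
  congr 1
  ring

theorem setIntegral_ball_comp_inner (n : ℕ) (R : ℝ) (f : ℝ → G)
    (ξ : EuclideanSpace ℝ (Fin (n + 1))) :
    ∫ x in Metric.ball (0 : EuclideanSpace ℝ (Fin (n + 1))) R, f (inner ℝ x ξ) =
      ∫ x in Metric.ball (0 : EuclideanSpace ℝ (Fin (n + 1))) R, f (‖ξ‖ * x 0) := by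
  set w : EuclideanSpace ℝ (Fin (n + 1)) := EuclideanSpace.single 0 ‖ξ‖ with hw
  set T := (Submodule.span ℝ {ξ - w})ᗮ.reflection
  have hTξ : T ξ = w := Submodule.reflection_sub (by simp [hw])
  have hball : T ⁻¹' Metric.ball 0 R = Metric.ball 0 R := by
    ext x; simp
  have hinner : ∀ x, inner ℝ x ξ = ‖ξ‖ * T x 0 := by
    intro x
    rw [← T.inner_map_map x ξ, hTξ, hw, EuclideanSpace.inner_single_right]
    simp
  simp only [hinner]
  rw [← T.measurePreserving.setIntegral_preimage_emb T.toHomeomorph.measurableEmbedding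
    (fun x => f (‖ξ‖ * x 0)), hball]

end Slicing

theorem charFun_restrict_ball (n : ℕ) {R : ℝ} (hR : 0 ≤ R)
    (ξ : EuclideanSpace ℝ (Fin (n + 1))) :
    charFun (volume.restrict (Metric.ball (0 : EuclideanSpace ℝ (Fin (n + 1))) R)) ξ =
      volume.real (Metric.ball (0 : EuclideanSpace ℝ (Fin n)) 1) * R ^ (n + 1) *
        besselIntegral (n + 1) (R * ‖ξ‖) := by
  rw [charFun_apply,
    setIntegral_ball_comp_inner n R (fun t => Complex.exp (t * Complex.I)) ξ,
    setIntegral_ball_comp_coord n hR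
      (f := fun t => Complex.exp ((‖ξ‖ * t : ℝ) * Complex.I)) (by fun_prop),
    intervalIntegral_sqrt_pow_smul n hR (by fun_prop), smul_smul, Complex.real_smul,
    besselIntegral, waveIntegral]
  push_cast
  congr 1
  refine intervalIntegral.integral_congr fun θ _ => ?_
  simp only [Complex.real_smul, Complex.ofReal_pow]
  rw [mul_comm]
  congr 2
  · ring
  · rw [Complex.ofReal_sin]

/-- The annulus `1 - δ ≤ |x| < 1 + δ` about the unit sphere, as a difference of open balls so that
its Fourier transform is a difference of theirs. -/
def annulus (d : ℕ) (δ : ℝ) : Set (EuclideanSpace ℝ (Fin d)) :=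
  Metric.ball 0 (1 + δ) \ Metric.ball 0 (1 - δ)

theorem volume_annulus_lt_top (d : ℕ) (δ : ℝ) : volume (annulus d δ) < ⊤ :=
  (measure_mono Set.sdiff_subset).trans_lt measure_ball_lt_top

instance (d : ℕ) (δ : ℝ) : IsFiniteMeasure (volume.restrict (annulus d δ)) :=
  isFiniteMeasure_restrict.2 (volume_annulus_lt_top d δ).ne

theorem volume_real_annulus_le (d : ℕ) {δ : ℝ} (h0 : 0 ≤ δ) (h1 : δ < 1) :
    volume.real (annulus d δ) ≤
      volume.real (Metric.ball (0 : EuclideanSpace ℝ (Fin d)) 1) * (d * 2 ^ d) * δ := by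
  rw [annulus, measureReal_sdiff (Metric.ball_subset_ball (by linarith)) measurableSet_ball
    measure_ball_lt_top.ne, volume_real_ball (by linarith), volume_real_ball (sub_pos.2 h1),
    ← sub_mul, mul_comm, mul_assoc]
  refine mul_le_mul_of_nonneg_left ?_ measureReal_nonneg
  have hmax : max |1 + δ| |1 - δ| ≤ 2 :=
    max_le (abs_le.2 ⟨by linarith, by linarith⟩) (abs_le.2 ⟨by linarith, by linarith⟩)
  calc (1 + δ) ^ d - (1 - δ) ^ d
      ≤ |1 + δ - (1 - δ)| * d * max |1 + δ| |1 - δ| ^ (d - 1) :=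
        (le_abs_self _).trans (abs_pow_sub_pow_le _ _ d)
    _ ≤ 2 * δ * d * 2 ^ (d - 1) := by
        rw [show 1 + δ - (1 - δ) = 2 * δ by ring, abs_of_nonneg (by positivity : 0 ≤ 2 * δ)]
        gcongr
    _ = d * 2 ^ d * δ := by
        rcases d with _ | d
        · simp
        · rw [Nat.add_sub_cancel]; ring

theorem norm_charFun_annulus_le (d : ℕ) {δ : ℝ} (h0 : 0 ≤ δ) (h1 : δ < 1)
    (ξ : EuclideanSpace ℝ (Fin d)) :
    ‖charFun (volume.restrict (annulus d δ)) ξ‖ ≤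
      volume.real (Metric.ball (0 : EuclideanSpace ℝ (Fin d)) 1) * (d * 2 ^ d) * δ := by
  refine le_trans ?_ (volume_real_annulus_le d h0 h1)
  simpa only [measureReal_restrict_apply_univ] using
    norm_charFun_le (μ := volume.restrict (annulus d δ)) ξ

theorem charFun_annulus (n : ℕ) {δ : ℝ} (h0 : 0 ≤ δ) (h1 : δ ≤ 1)
    {ξ : EuclideanSpace ℝ (Fin (n + 1))} (hξ : ξ ≠ 0) :
    charFun (volume.restrict (annulus (n + 1) δ)) ξ =
      volume.real (Metric.ball (0 : EuclideanSpace ℝ (Fin n)) 1) * (‖ξ‖ : ℂ)⁻¹ ^ (n + 1) *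
        ((((1 + δ) * ‖ξ‖ : ℝ) : ℂ) ^ (n + 1) * besselIntegral (n + 1) ((1 + δ) * ‖ξ‖) -
          (((1 - δ) * ‖ξ‖ : ℝ) : ℂ) ^ (n + 1) * besselIntegral (n + 1) ((1 - δ) * ‖ξ‖)) := by
  have hsdiff := setIntegral_sdiff (μ := volume) measurableSet_ball
    (integrableOn_ball_of_continuous (f := fun x : EuclideanSpace ℝ (Fin (n + 1)) =>
      Complex.exp (inner ℝ x ξ * Complex.I)) (by fun_prop) 0 (1 + δ))
    (Metric.ball_subset_ball (by linarith : 1 - δ ≤ 1 + δ))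
  have houter := charFun_restrict_ball n (by linarith : 0 ≤ 1 + δ) ξ
  have hinner := charFun_restrict_ball n (sub_nonneg.2 h1) ξ
  rw [charFun_apply] at houter hinner
  have hξ' : (‖ξ‖ : ℂ) ≠ 0 := by exact_mod_cast norm_ne_zero_iff.2 hξ
  rw [charFun_apply, annulus, hsdiff, houter, hinner]
  push_cast
  simp only [mul_pow, inv_pow]
  field_simp

theorem exists_norm_pow_mul_besselIntegral_sub_le (k : ℕ) :
    ∃ C, 0 ≤ C ∧ ∀ a b : ℝ, 0 < a → a ≤ b →
      ‖(b : ℂ) ^ (k + 2) * besselIntegral (k + 2) b -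
        (a : ℂ) ^ (k + 2) * besselIntegral (k + 2) a‖ ≤
        C * b ^ ((k + 1 : ℝ) / 2) * (b - a) := by
  obtain ⟨C, hC, hbessel⟩ := exists_norm_besselIntegral_le_rpow k
  refine ⟨(k + 1) * C, by positivity, fun a b ha hab => ?_⟩
  have hderiv : ∀ s ∈ Set.Icc a b,
      ‖(k + 1) * (s : ℂ) ^ (k + 1) * besselIntegral k s‖ ≤
        (k + 1) * C * b ^ ((k + 1 : ℝ) / 2) := by
    intro s hs
    have hs0 : 0 < s := ha.trans_le hs.1
    have hk : ‖(k + 1 : ℂ)‖ = k + 1 := by exact_mod_cast Complex.norm_natCast (k + 1)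
    have hpow : s ^ (k + 1) * s ^ (-((k + 1 : ℝ) / 2)) = s ^ ((k + 1 : ℝ) / 2) := by
      rw [← Real.rpow_natCast, ← Real.rpow_add hs0]
      congr 1; push_cast; ring
    rw [norm_mul, norm_mul, norm_pow, hk, Complex.norm_real, Real.norm_of_nonneg hs0.le]
    calc (k + 1) * s ^ (k + 1) * ‖besselIntegral k s‖
        ≤ (k + 1) * s ^ (k + 1) * (C * s ^ (-((k + 1 : ℝ) / 2))) := by
          gcongr; exact hbessel s hs0
      _ = (k + 1) * C * s ^ ((k + 1 : ℝ) / 2) := by rw [← hpow]; ring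
      _ ≤ (k + 1) * C * b ^ ((k + 1 : ℝ) / 2) := by gcongr; exact hs.2
  have hmean := (convex_Icc a b).norm_image_sub_le_of_norm_hasDerivWithin_le
    (fun s _ => (hasDerivAt_pow_mul_besselIntegral k s).hasDerivWithinAt) hderiv
    (Set.left_mem_Icc.2 hab) (Set.right_mem_Icc.2 hab)
  rwa [Real.norm_of_nonneg (sub_nonneg.2 hab)] at hmean

theorem exists_norm_charFun_annulus_le_rpow (k : ℕ) :
    ∃ C, ∀ δ, 0 ≤ δ → δ < 1 → ∀ ξ : EuclideanSpace ℝ (Fin (k + 2)), ξ ≠ 0 →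
      ‖charFun (volume.restrict (annulus (k + 2) δ)) ξ‖ ≤ C * δ * ‖ξ‖ ^ (-((k + 1 : ℝ) / 2)) := by
  obtain ⟨C, hC, hincr⟩ := exists_norm_pow_mul_besselIntegral_sub_le k
  set v := volume.real (Metric.ball (0 : EuclideanSpace ℝ (Fin (k + 1))) 1)
  refine ⟨v * (C * 2 ^ ((k + 1 : ℝ) / 2) * 2), fun δ h0 h1 ξ hξ => ?_⟩
  rw [charFun_annulus (k + 1) h0 h1.le hξ, norm_mul, norm_mul, norm_pow, norm_inv,
    Complex.norm_real, Complex.norm_real, norm_norm, Real.norm_of_nonneg measureReal_nonneg]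
  have hr0 : 0 < ‖ξ‖ := norm_pos_iff.2 hξ
  set r := ‖ξ‖
  have hexp : r⁻¹ ^ (k + 2) * r ^ ((k + 1 : ℝ) / 2) * r = r ^ (-((k + 1 : ℝ) / 2)) := by
    rw [inv_pow, ← Real.rpow_natCast r (k + 2), ← Real.rpow_neg hr0.le, ← Real.rpow_add hr0,
      ← Real.rpow_add_one hr0.ne']
    congr 1; push_cast; ring
  calc v * r⁻¹ ^ (k + 2) * _
      ≤ v * r⁻¹ ^ (k + 2) *
          (C * ((1 + δ) * r) ^ ((k + 1 : ℝ) / 2) * ((1 + δ) * r - (1 - δ) * r)) := by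
        gcongr
        exact hincr _ _ (mul_pos (sub_pos.2 h1) hr0) (by gcongr; linarith)
    _ ≤ v * r⁻¹ ^ (k + 2) * (C * (2 * r) ^ ((k + 1 : ℝ) / 2) * (2 * δ * r)) := by
        rw [show (1 + δ) * r - (1 - δ) * r = 2 * δ * r by ring]
        gcongr
        linarith
    _ = v * (C * 2 ^ ((k + 1 : ℝ) / 2) * 2) * δ * r ^ (-((k + 1 : ℝ) / 2)) := by
        rw [Real.mul_rpow zero_le_two hr0.le, ← hexp]
        ring

theorem exists_norm_charFun_annulus_le_max_rpow (n : ℕ) :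
    ∃ C, 0 ≤ C ∧ ∀ δ, 0 ≤ δ → δ < 1 → ∀ ξ : EuclideanSpace ℝ (Fin (n + 1)),
      ‖charFun (volume.restrict (annulus (n + 1) δ)) ξ‖ ≤
        C * δ * max 1 ‖ξ‖ ^ (-(n / 2 : ℝ)) := by
  set M := volume.real (Metric.ball (0 : EuclideanSpace ℝ (Fin (n + 1))) 1) *
    (((n + 1 : ℕ) : ℝ) * 2 ^ (n + 1))
  have hM : 0 ≤ M := by positivity
  rcases n with _ | k
  · exact ⟨M, hM, fun δ h0 h1 ξ => by
      simpa only [CharP.cast_eq_zero, zero_div, neg_zero, Real.rpow_zero, mul_one] using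
        norm_charFun_annulus_le 1 h0 h1 ξ⟩
  obtain ⟨C, hdecay⟩ := exists_norm_charFun_annulus_le_rpow k
  refine ⟨max M C, le_max_of_le_left hM, fun δ h0 h1 ξ => ?_⟩
  rcases le_total ‖ξ‖ 1 with h | h
  · rw [max_eq_left h, Real.one_rpow, mul_one]
    exact (norm_charFun_annulus_le (k + 2) h0 h1 ξ).trans (by gcongr; exact le_max_left _ _)
  · rw [max_eq_right h, Nat.cast_add_one]
    refine (hdecay δ h0 h1 ξ (norm_pos_iff.1 (one_pos.trans_le h))).trans ?_
    gcongr
    exact le_max_right _ _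

/-! ### Gaussians and difference measures -/

section Gaussian

variable {V : Type*} [NormedAddCommGroup V] [InnerProductSpace ℝ V] [FiniteDimensional ℝ V]
  [MeasurableSpace V] [BorelSpace V]

theorem integrable_exp_neg_norm_sq {c : ℝ} (hc : 0 < c) :
    Integrable (fun ξ : V => Real.exp (-c * ‖ξ‖ ^ 2)) := by
  have h := (GaussianFourier.integrable_cexp_neg_mul_sq_norm_add (V := V) (b := (c : ℂ))
    (by simpa using hc) 0 0).re
  refine h.congr (Filter.Eventually.of_forall fun ξ => ?_)
  have : (-(c : ℂ) * (‖ξ‖ : ℂ) ^ 2 + 0 * ((inner ℝ (0 : V) ξ : ℝ) : ℂ)) =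
      ((-c * ‖ξ‖ ^ 2 : ℝ) : ℂ) := by push_cast; ring
  simp only [this]
  rw [← Complex.ofReal_exp]
  exact Complex.ofReal_re _

theorem integral_gaussian_mul_exp_inner {b : ℝ} (hb : 0 < b) (w : V) :
    ∫ ξ : V, (Real.exp (-(4 * b)⁻¹ * ‖ξ‖ ^ 2) : ℂ) * Complex.exp (inner ℝ w ξ * Complex.I) =
      (((4 * Real.pi * b) ^ (Module.finrank ℝ V / 2 : ℝ) : ℝ) : ℂ) *
        (Real.exp (-b * ‖w‖ ^ 2) : ℂ) := by
  convert! GaussianFourier.integral_cexp_neg_mul_sq_norm_add (V := V)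
    (b := (((4 * b)⁻¹ : ℝ) : ℂ)) (by rw [Complex.ofReal_re]; positivity) Complex.I w using 2
  · funext ξ
    rw [Complex.ofReal_exp, ← Complex.exp_add]
    congr 1
    push_cast
    ring
  · rw [← Complex.ofReal_div, Complex.ofReal_cpow (by positivity)]
    push_cast
    congr 1
    field_simp
  · rw [Complex.I_sq, Complex.ofReal_exp]
    congr 1
    push_cast
    have : (b : ℂ) ≠ 0 := by exact_mod_cast hb.ne'
    field_simp

theorem integrable_gaussian_mul_exp_inner (ρ : Measure V) [IsFiniteMeasure ρ] {c : ℝ}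
    (hc : 0 < c) :
    Integrable (fun p : V × V => (Real.exp (-c * ‖p.1‖ ^ 2) : ℂ) *
      Complex.exp (inner ℝ p.2 p.1 * Complex.I)) (volume.prod ρ) := by
  refine ((integrable_exp_neg_norm_sq (V := V) hc).mul_prod
    (integrable_const (μ := ρ) (1 : ℝ))).mono (by fun_prop)
    (Filter.Eventually.of_forall fun p => ?_)
  rw [norm_mul, norm_mul, Complex.norm_exp_ofReal_mul_I, Complex.norm_real, norm_one]

theorem integral_gaussian_eq_integral_charFun (ρ : Measure V) [IsFiniteMeasure ρ] {b : ℝ}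
    (hb : 0 < b) :
    (((4 * Real.pi * b) ^ (Module.finrank ℝ V / 2 : ℝ) : ℝ) : ℂ) *
        ((∫ w, Real.exp (-b * ‖w‖ ^ 2) ∂ρ : ℝ) : ℂ) =
      ∫ ξ : V, (Real.exp (-(4 * b)⁻¹ * ‖ξ‖ ^ 2) : ℂ) * charFun ρ ξ := by
  calc _ = ∫ w, ∫ ξ : V, (Real.exp (-(4 * b)⁻¹ * ‖ξ‖ ^ 2) : ℂ) *
      Complex.exp (inner ℝ w ξ * Complex.I) ∂volume ∂ρ := by
        simp only [integral_gaussian_mul_exp_inner hb]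
        rw [integral_const_mul, ← integral_complex_ofReal]
    _ = ∫ ξ : V, ∫ w, (Real.exp (-(4 * b)⁻¹ * ‖ξ‖ ^ 2) : ℂ) *
      Complex.exp (inner ℝ w ξ * Complex.I) ∂ρ :=
        (integral_integral_swap (integrable_gaussian_mul_exp_inner ρ (by positivity))).symm
    _ = _ := by simp only [charFun_apply, integral_const_mul]

/-- The difference measure of `μ`, that is, the distribution of `x - y` under `μ × μ`; its Fourier
transform is the square modulus of that of `μ`. -/
def diffMeasure (μ : Measure V) : Measure V :=
  Measure.conv μ (μ.map fun x => (-1 : ℝ) • x)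

instance (μ : Measure V) [IsFiniteMeasure μ] : IsFiniteMeasure (diffMeasure μ) := by
  unfold diffMeasure; infer_instance

theorem charFun_diffMeasure (μ : Measure V) [IsFiniteMeasure μ] (ξ : V) :
    charFun (diffMeasure μ) ξ = ((‖charFun μ ξ‖ ^ 2 : ℝ) : ℂ) := by
  rw [diffMeasure, charFun_conv, charFun_map_smul, neg_one_smul, charFun_neg, Complex.mul_conj,
    Complex.normSq_eq_norm_sq]

theorem lintegral_diffMeasure (μ : Measure V) [IsFiniteMeasure μ] {f : V → ℝ≥0∞}
    (hf : Measurable f) :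
    ∫⁻ w, f w ∂(diffMeasure μ) = ∫⁻ x, ∫⁻ y, f (x - y) ∂μ ∂μ := by
  rw [diffMeasure, Measure.lintegral_conv hf]
  refine lintegral_congr fun x => ?_
  rw [lintegral_map (by fun_prop) (by fun_prop)]
  simp only [neg_smul, one_smul, sub_eq_add_neg]

theorem integrable_gaussian_mul_norm_charFun_sq (μ : Measure V) [IsFiniteMeasure μ] {c : ℝ}
    (hc : 0 < c) :
    Integrable fun ξ : V => Real.exp (-c * ‖ξ‖ ^ 2) * ‖charFun μ ξ‖ ^ 2 := by
  refine (integrable_exp_neg_norm_sq (V := V) hc).mul_bdd (c := μ.real Set.univ ^ 2) ?_ ?_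
  · exact ((measurable_charFun (μ := μ)).norm.pow_const 2).aestronglyMeasurable
  · refine Filter.Eventually.of_forall fun ξ => ?_
    rw [Real.norm_of_nonneg (by positivity)]
    exact pow_le_pow_left₀ (norm_nonneg _) (norm_charFun_le ξ) 2

theorem integral_gaussian_diffMeasure (μ : Measure V) [IsFiniteMeasure μ] {b : ℝ} (hb : 0 < b) :
    (4 * Real.pi * b) ^ (Module.finrank ℝ V / 2 : ℝ) *
        ∫ w, Real.exp (-b * ‖w‖ ^ 2) ∂(diffMeasure μ) =
      ∫ ξ : V, Real.exp (-(4 * b)⁻¹ * ‖ξ‖ ^ 2) * ‖charFun μ ξ‖ ^ 2 := by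
  have h := integral_gaussian_eq_integral_charFun (diffMeasure μ) hb
  simp only [charFun_diffMeasure] at h
  rw [← Complex.ofReal_inj, Complex.ofReal_mul, h, ← integral_complex_ofReal]
  push_cast
  rfl

theorem integral_gaussian_le_sum_of_norm_charFun_le {ι : Type*} {s : Finset ι} {ρ μ : Measure V}
    [IsFiniteMeasure ρ] [IsFiniteMeasure μ] {b : ℝ} (hb : 0 < b) {c β : ι → ℝ}
    (hβ : ∀ j ∈ s, 0 < β j)
    (h : ∀ ξ : V, Real.exp (-(4 * b)⁻¹ * ‖ξ‖ ^ 2) * ‖charFun ρ ξ‖ ≤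
      ∑ j ∈ s, c j * (Real.exp (-(4 * β j)⁻¹ * ‖ξ‖ ^ 2) * ‖charFun μ ξ‖ ^ 2)) :
    b ^ (Module.finrank ℝ V / 2 : ℝ) * ∫ w, Real.exp (-b * ‖w‖ ^ 2) ∂ρ ≤
      ∑ j ∈ s, c j * (β j ^ (Module.finrank ℝ V / 2 : ℝ) *
        ∫ w, Real.exp (-β j * ‖w‖ ^ 2) ∂(diffMeasure μ)) := by
  set q : ℝ := Module.finrank ℝ V / 2
  have hint : ∀ j ∈ s, Integrable fun ξ : V =>
      c j * (Real.exp (-(4 * β j)⁻¹ * ‖ξ‖ ^ 2) * ‖charFun μ ξ‖ ^ 2) := fun j hj =>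
    (integrable_gaussian_mul_norm_charFun_sq μ (by have := hβ j hj; positivity)).const_mul _
  have hpi : (0 : ℝ) < (4 * Real.pi) ^ q := by positivity
  refine le_of_mul_le_mul_left ?_ hpi
  calc (4 * Real.pi) ^ q * (b ^ q * ∫ w, Real.exp (-b * ‖w‖ ^ 2) ∂ρ)
      = ‖(((4 * Real.pi * b) ^ q : ℝ) : ℂ) *
          ((∫ w, Real.exp (-b * ‖w‖ ^ 2) ∂ρ : ℝ) : ℂ)‖ := by
        have : 0 ≤ ∫ w, Real.exp (-b * ‖w‖ ^ 2) ∂ρ :=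
          integral_nonneg fun w => (Real.exp_pos _).le
        rw [← Complex.ofReal_mul, Complex.norm_real, Real.norm_of_nonneg (by positivity),
          Real.mul_rpow (by positivity) hb.le, mul_assoc]
    _ ≤ ∫ ξ : V, ∑ j ∈ s, c j * (Real.exp (-(4 * β j)⁻¹ * ‖ξ‖ ^ 2) * ‖charFun μ ξ‖ ^ 2) := by
        rw [integral_gaussian_eq_integral_charFun ρ hb]
        refine norm_integral_le_of_norm_le (integrable_finsetSum s hint)
          (Filter.Eventually.of_forall fun ξ => ?_)
        rw [norm_mul, Complex.norm_real, Real.norm_of_nonneg (Real.exp_pos _).le]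
        exact h ξ
    _ = (4 * Real.pi) ^ q * ∑ j ∈ s, c j * (β j ^ q *
          ∫ w, Real.exp (-β j * ‖w‖ ^ 2) ∂(diffMeasure μ)) := by
        rw [integral_finsetSum s hint, Finset.mul_sum]
        refine Finset.sum_congr rfl fun j hj => ?_
        rw [integral_const_mul, ← integral_gaussian_diffMeasure μ (hβ j hj),
          Real.mul_rpow (by positivity) (hβ j hj).le]
        ring

theorem integral_gaussian_diffMeasure_conv_le {ι : Type*} {s : Finset ι} {μ a : Measure V}
    [IsFiniteMeasure μ] [IsFiniteMeasure a] {b : ℝ} (hb : 0 < b) {c β : ι → ℝ}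
    (hβ : ∀ j ∈ s, 0 < β j)
    (h : ∀ ξ : V, Real.exp (-(4 * b)⁻¹ * ‖ξ‖ ^ 2) * ‖charFun a ξ‖ ≤
      ∑ j ∈ s, c j * Real.exp (-(4 * β j)⁻¹ * ‖ξ‖ ^ 2)) :
    b ^ (Module.finrank ℝ V / 2 : ℝ) *
        ∫ w, Real.exp (-b * ‖w‖ ^ 2) ∂(Measure.conv (diffMeasure μ) a) ≤
      ∑ j ∈ s, c j * (β j ^ (Module.finrank ℝ V / 2 : ℝ) *
        ∫ w, Real.exp (-β j * ‖w‖ ^ 2) ∂(diffMeasure μ)) := by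
  refine integral_gaussian_le_sum_of_norm_charFun_le hb hβ fun ξ => ?_
  rw [charFun_conv, charFun_diffMeasure, norm_mul, Complex.norm_real,
    Real.norm_of_nonneg (by positivity)]
  calc Real.exp (-(4 * b)⁻¹ * ‖ξ‖ ^ 2) * (‖charFun μ ξ‖ ^ 2 * ‖charFun a ξ‖)
      = (Real.exp (-(4 * b)⁻¹ * ‖ξ‖ ^ 2) * ‖charFun a ξ‖) * ‖charFun μ ξ‖ ^ 2 := by ring
    _ ≤ (∑ j ∈ s, c j * Real.exp (-(4 * β j)⁻¹ * ‖ξ‖ ^ 2)) * ‖charFun μ ξ‖ ^ 2 := by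
      gcongr; exact h ξ
    _ = _ := by rw [Finset.sum_mul]; simp only [mul_assoc]

end Gaussian

theorem gaussian_mul_max_rpow_le_sum_two_pow {σ b r : ℝ} (hσ : 0 ≤ σ) (hb0 : 0 < b) {J : ℕ}
    (hb : b ≤ ((2 : ℝ) ^ J) ^ 2) (hr : 0 ≤ r) :
    Real.exp (-(4 * b)⁻¹ * r ^ 2) * max 1 r ^ (-σ) ≤
      Real.exp 1 * ∑ j ∈ Finset.range (J + 1),
        ((2 : ℝ) ^ j) ^ (-σ) * Real.exp (-(4 * ((2 : ℝ) ^ j) ^ 2)⁻¹ * r ^ 2) := by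
  obtain ⟨i, hi, hi'⟩ := exists_nat_pow_near (le_max_left 1 r) one_lt_two
  -- the single summand at the scale `2 ^ min i J` already dominates the left side
  set j := min i J
  have hpow : max 1 r ^ (-σ) ≤ ((2 : ℝ) ^ j) ^ (-σ) :=
    Real.rpow_le_rpow_of_nonpos (by positivity)
      ((pow_le_pow_right₀ one_le_two (min_le_left i J)).trans hi) (neg_nonpos.2 hσ)
  have hexp : Real.exp (-(4 * b)⁻¹ * r ^ 2) ≤
      Real.exp 1 * Real.exp (-(4 * ((2 : ℝ) ^ j) ^ 2)⁻¹ * r ^ 2) := by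
    rw [← Real.exp_add, Real.exp_le_exp]
    rcases le_total i J with h | h
    · have hscale : (4 * ((2 : ℝ) ^ j) ^ 2)⁻¹ * r ^ 2 ≤ 1 := by
        rw [show j = i from min_eq_left h, inv_mul_le_one₀ (by positivity)]
        calc r ^ 2 ≤ ((2 : ℝ) ^ (i + 1)) ^ 2 := by
              gcongr; exact (le_max_right 1 r).trans hi'.le
          _ = 4 * ((2 : ℝ) ^ i) ^ 2 := by ring
      have : 0 ≤ (4 * b)⁻¹ * r ^ 2 := by positivity
      linarith
    · have hscale : (4 * ((2 : ℝ) ^ j) ^ 2)⁻¹ * r ^ 2 ≤ (4 * b)⁻¹ * r ^ 2 := by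
        rw [show j = J from min_eq_right h]
        gcongr
      linarith
  calc Real.exp (-(4 * b)⁻¹ * r ^ 2) * max 1 r ^ (-σ)
      ≤ Real.exp 1 * Real.exp (-(4 * ((2 : ℝ) ^ j) ^ 2)⁻¹ * r ^ 2) * ((2 : ℝ) ^ j) ^ (-σ) := by
        gcongr
    _ = Real.exp 1 * (((2 : ℝ) ^ j) ^ (-σ) *
          Real.exp (-(4 * ((2 : ℝ) ^ j) ^ 2)⁻¹ * r ^ 2)) := by ring
    _ ≤ _ := by
        gcongr
        exact Finset.single_le_sum
          (f := fun j => ((2 : ℝ) ^ j) ^ (-σ) * Real.exp (-(4 * ((2 : ℝ) ^ j) ^ 2)⁻¹ * r ^ 2))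
          (fun _ _ => by positivity)
          (Finset.mem_range.2 (Nat.lt_succ_of_le (min_le_right i J)))

theorem summable_exp_neg_mul_add_one_rpow (α : ℝ) :
    Summable fun m : ℕ => Real.exp (-m) * ((m : ℝ) + 1) ^ α := by
  have h := (summable_nat_add_iff 1).2 (Real.summable_pow_mul_exp_neg_nat_mul ⌈α⌉₊ one_pos)
  refine Summable.of_nonneg_of_le (fun m => by positivity) (fun m => ?_) (h.mul_left (Real.exp 1))
  have hpow : ((m : ℝ) + 1) ^ α ≤ ((m : ℝ) + 1) ^ ⌈α⌉₊ := by
    rw [← Real.rpow_natCast]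
    exact Real.rpow_le_rpow_of_exponent_le (by linarith [m.cast_nonneg (α := ℝ)]) (Nat.le_ceil α)
  calc Real.exp (-m) * ((m : ℝ) + 1) ^ α ≤ Real.exp (-m) * ((m : ℝ) + 1) ^ ⌈α⌉₊ := by gcongr
    _ = Real.exp 1 * (((m + 1 : ℕ) : ℝ) ^ ⌈α⌉₊ * Real.exp (-1 * ((m + 1 : ℕ) : ℝ))) := by
      rw [mul_comm (Real.exp 1), mul_assoc, ← Real.exp_add]
      push_cast
      ring_nf

section BallGrowth

variable {X : Type*} [PseudoMetricSpace X]

theorem exp_neg_dist_sq_le_tsum_indicator_ball {r : ℝ} (hr : 0 < r) (x y : X) :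
    ENNReal.ofReal (Real.exp (-(r ^ 2)⁻¹ * dist x y ^ 2)) ≤
      ∑' m : ℕ, (Metric.ball x ((m + 1) * r)).indicator
        (fun _ => ENNReal.ofReal (Real.exp (-m))) y := by
  set t := dist x y / r with ht
  have hmem : y ∈ Metric.ball x ((⌊t⌋₊ + 1) * r) := by
    rw [Metric.mem_ball, dist_comm, ← div_lt_iff₀ hr]
    exact Nat.lt_floor_add_one t
  refine le_trans ?_ (ENNReal.le_tsum ⌊t⌋₊)
  rw [Set.indicator_of_mem hmem]
  refine ENNReal.ofReal_le_ofReal (Real.exp_le_exp.2 ?_)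
  have hsq : (⌊t⌋₊ : ℝ) ≤ t ^ 2 :=
    calc (⌊t⌋₊ : ℝ) ≤ (⌊t⌋₊ : ℝ) ^ 2 := by exact_mod_cast Nat.le_self_pow two_ne_zero _
      _ ≤ t ^ 2 := by gcongr; exact Nat.floor_le (by positivity)
  have hexp : (r ^ 2)⁻¹ * dist x y ^ 2 = t ^ 2 := by rw [ht, div_pow, div_eq_inv_mul]
  linarith

theorem lintegral_exp_neg_dist_sq_le [MeasurableSpace X] [OpensMeasurableSpace X] {ν : Measure X}
    {A α r : ℝ} (hA : 0 ≤ A) (hr : 0 < r) {x : X}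
    (h : ∀ R, r ≤ R → ν (Metric.ball x R) ≤ ENNReal.ofReal (A * R ^ α)) :
    ∫⁻ y, ENNReal.ofReal (Real.exp (-(r ^ 2)⁻¹ * dist x y ^ 2)) ∂ν ≤
      ENNReal.ofReal (A * r ^ α * ∑' m : ℕ, Real.exp (-m) * ((m : ℝ) + 1) ^ α) := by
  calc ∫⁻ y, ENNReal.ofReal (Real.exp (-(r ^ 2)⁻¹ * dist x y ^ 2)) ∂ν
      ≤ ∫⁻ y, ∑' m : ℕ, (Metric.ball x ((m + 1) * r)).indicator
          (fun _ => ENNReal.ofReal (Real.exp (-m))) y ∂ν :=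
        lintegral_mono fun y => exp_neg_dist_sq_le_tsum_indicator_ball hr x y
    _ = ∑' m : ℕ, ENNReal.ofReal (Real.exp (-m)) * ν (Metric.ball x ((m + 1) * r)) := by
        rw [lintegral_tsum fun m => (measurable_const.indicator measurableSet_ball).aemeasurable]
        refine tsum_congr fun m => ?_
        rw [lintegral_indicator measurableSet_ball, setLIntegral_const]
    _ ≤ ∑' m : ℕ, ENNReal.ofReal (A * r ^ α * (Real.exp (-m) * ((m : ℝ) + 1) ^ α)) := by
        refine ENNReal.tsum_le_tsum fun m => ?_
        have hle : r ≤ (m + 1) * r := le_mul_of_one_le_left hr.le (by simp)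
        refine (mul_le_mul_right (h _ hle) _).trans (le_of_eq ?_)
        rw [← ENNReal.ofReal_mul (Real.exp_pos _).le, Real.mul_rpow (by positivity) hr.le]
        congr 1; ring
    _ = _ := by
        rw [← ENNReal.ofReal_tsum_of_nonneg (fun m => by positivity)
          ((summable_exp_neg_mul_add_one_rpow α).mul_left _), tsum_mul_left]

end BallGrowth

/-! ### The volume of the neighbourhoods of the set of unit pairs -/

section DiffMeasure

variable {V : Type*} [NormedAddCommGroup V] [InnerProductSpace ℝ V] [FiniteDimensional ℝ V]
  [MeasurableSpace V] [BorelSpace V]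

theorem integral_gaussian_diffMeasure_le {μ : Measure V} [IsFiniteMeasure μ] {A α r : ℝ}
    (hA : 0 ≤ A) (hr : 0 < r)
    (h : ∀ x R, r ≤ R → μ (Metric.ball x R) ≤ ENNReal.ofReal (A * R ^ α)) :
    ∫ w, Real.exp (-(r ^ 2)⁻¹ * ‖w‖ ^ 2) ∂(diffMeasure μ) ≤
      A * r ^ α * (∑' m : ℕ, Real.exp (-m) * ((m : ℝ) + 1) ^ α) * μ.real Set.univ := by
  have : 0 ≤ ∑' m : ℕ, Real.exp (-m) * ((m : ℝ) + 1) ^ α :=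
    tsum_nonneg fun m => by positivity
  rw [integral_eq_lintegral_of_nonneg_ae
    (Filter.Eventually.of_forall fun w => (Real.exp_pos _).le) (by fun_prop)]
  refine ENNReal.toReal_le_of_le_ofReal (by positivity) ?_
  rw [lintegral_diffMeasure _ (by fun_prop)]
  simp only [← dist_eq_norm]
  calc _ ≤ ∫⁻ _, ENNReal.ofReal _ ∂μ :=
        lintegral_mono fun x => lintegral_exp_neg_dist_sq_le hA hr (h x)
    _ = _ := by
        rw [lintegral_const, ENNReal.ofReal_mul (p := A * r ^ α * _) (by positivity),
          ofReal_measureReal]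

theorem diffMeasure_apply (μ : Measure V) [IsFiniteMeasure μ] {S : Set V} (hS : MeasurableSet S) :
    diffMeasure μ S = (μ.prod μ) {p | p.1 - p.2 ∈ S} := by
  have hpre : MeasurableSet {p : V × V | p.1 - p.2 ∈ S} := (measurable_fst.sub measurable_snd) hS
  rw [← lintegral_indicator_one hS, lintegral_diffMeasure _ (measurable_one.indicator hS),
    ← lintegral_indicator_one hpre,
    lintegral_prod _ (measurable_one.indicator hpre).aemeasurable]
  rfl

theorem integrable_exp_neg_mul_norm_sq (ρ : Measure V) [IsFiniteMeasure ρ] {b : ℝ} (hb : 0 ≤ b) :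
    Integrable (fun w : V => Real.exp (-b * ‖w‖ ^ 2)) ρ := by
  refine (integrable_const (1 : ℝ)).mono (by fun_prop) (Filter.Eventually.of_forall fun w => ?_)
  rw [Real.norm_of_nonneg (Real.exp_pos _).le, norm_one, Real.exp_le_one_iff, neg_mul]
  exact neg_nonpos.2 (by positivity)

theorem exp_neg_one_mul_measureReal_ball_le_integral (a : Measure V) [IsFiniteMeasure a]
    {ε : ℝ} (hε : 0 < ε) (w : V) :
    Real.exp (-1) * a.real (Metric.ball (-w) ε) ≤
      ∫ u, Real.exp (-(ε ^ 2)⁻¹ * ‖w + u‖ ^ 2) ∂a := by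
  have hint : Integrable (fun u => Real.exp (-(ε ^ 2)⁻¹ * ‖w + u‖ ^ 2)) a := by
    refine (integrable_map_measure (f := (w + ·)) (by fun_prop) (by fun_prop)).1
      (integrable_exp_neg_mul_norm_sq (a.map (w + ·)) (b := (ε ^ 2)⁻¹) (by positivity))
  calc Real.exp (-1) * a.real (Metric.ball (-w) ε)
      = ∫ _ in Metric.ball (-w) ε, Real.exp (-1) ∂a := by
        rw [setIntegral_const, smul_eq_mul, mul_comm]
    _ ≤ ∫ u in Metric.ball (-w) ε, Real.exp (-(ε ^ 2)⁻¹ * ‖w + u‖ ^ 2) ∂a := by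
        refine setIntegral_mono_on (integrable_const _) hint.integrableOn measurableSet_ball
          fun u hu => Real.exp_le_exp.2 ?_
        rw [mem_ball_iff_norm, sub_neg_eq_add, add_comm u w] at hu
        have : (ε ^ 2)⁻¹ * ‖w + u‖ ^ 2 ≤ 1 := by
          rw [inv_mul_le_iff₀ (by positivity), mul_one]
          exact pow_le_pow_left₀ (norm_nonneg _) hu.le 2
        linarith
    _ ≤ _ := setIntegral_le_integral hint (Filter.Eventually.of_forall fun u => (Real.exp_pos _).le)

theorem exp_neg_one_mul_mul_measureReal_le_integral_conv {κ a : Measure V} [IsFiniteMeasure κ]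
    [IsFiniteMeasure a] {S : Set V} (hS : MeasurableSet S) {ε c : ℝ} (hε : 0 < ε)
    (h : ∀ w ∈ S, c ≤ a.real (Metric.ball (-w) ε)) :
    Real.exp (-1) * c * κ.real S ≤
      ∫ w, Real.exp (-(ε ^ 2)⁻¹ * ‖w‖ ^ 2) ∂(Measure.conv κ a) := by
  have hint := integrable_exp_neg_mul_norm_sq (Measure.conv κ a) (b := (ε ^ 2)⁻¹) (by positivity)
  have hint' : Integrable (fun w => ∫ u, Real.exp (-(ε ^ 2)⁻¹ * ‖w + u‖ ^ 2) ∂a) κ :=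
    ((integrable_map_measure (by fun_prop) (by fun_prop)).1 hint).integral_prod_left
  rw [integral_conv hint]
  calc Real.exp (-1) * c * κ.real S = ∫ _ in S, Real.exp (-1) * c ∂κ := by
        rw [setIntegral_const, smul_eq_mul, mul_comm]
    _ ≤ ∫ w in S, ∫ u, Real.exp (-(ε ^ 2)⁻¹ * ‖w + u‖ ^ 2) ∂a ∂κ := by
        refine setIntegral_mono_on (integrable_const _) hint'.integrableOn hS fun w hw => ?_
        exact (mul_le_mul_of_nonneg_left (h w hw) (Real.exp_pos _).le).trans
          (exp_neg_one_mul_measureReal_ball_le_integral a hε w)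
    _ ≤ _ := setIntegral_le_integral hint' (Filter.Eventually.of_forall fun w =>
        integral_nonneg fun u => (Real.exp_pos _).le)

end DiffMeasure

theorem ball_neg_subset_annulus {d : ℕ} {ε : ℝ} {w : EuclideanSpace ℝ (Fin d)}
    (hw : |‖w‖ - 1| < ε) : Metric.ball (-w) ε ⊆ annulus d (2 * ε) := by
  have hw' := abs_lt.1 hw
  intro u hu
  rw [mem_ball_iff_norm, sub_neg_eq_add] at hu
  have h1 : ‖u‖ ≤ ‖u + w‖ + ‖w‖ := by simpa using norm_sub_le (u + w) w
  have h2 : ‖w‖ ≤ ‖u + w‖ + ‖u‖ := by simpa using norm_sub_le (u + w) u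
  constructor <;> rw [mem_ball_zero_iff] <;> linarith

theorem exists_gaussian_mul_norm_charFun_annulus_le_sum (n : ℕ) :
    ∃ C : ℝ, 0 ≤ C ∧ ∀ ε : ℝ, 0 < ε → ε < 1 / 2 → ∀ J : ℕ, ε⁻¹ ≤ 2 ^ J →
      ∀ ξ : EuclideanSpace ℝ (Fin (n + 1)),
        Real.exp (-(4 * (ε ^ 2)⁻¹)⁻¹ * ‖ξ‖ ^ 2) *
            ‖charFun (volume.restrict (annulus (n + 1) (2 * ε))) ξ‖ ≤
          ∑ j ∈ Finset.range (J + 1), C * ε * ((2 : ℝ) ^ j) ^ (-(n / 2 : ℝ)) *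
            Real.exp (-(4 * ((2 : ℝ) ^ j) ^ 2)⁻¹ * ‖ξ‖ ^ 2) := by
  obtain ⟨C, hC0, hC⟩ := exists_norm_charFun_annulus_le_max_rpow n
  refine ⟨2 * C * Real.exp 1, by positivity, fun ε hε hε2 J hJ ξ => ?_⟩
  calc _ ≤ Real.exp (-(4 * (ε ^ 2)⁻¹)⁻¹ * ‖ξ‖ ^ 2) *
        (C * (2 * ε) * max 1 ‖ξ‖ ^ (-(n / 2 : ℝ))) := by
        gcongr; exact hC _ (by linarith) (by linarith) ξ
    _ = C * (2 * ε) *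
        (Real.exp (-(4 * (ε ^ 2)⁻¹)⁻¹ * ‖ξ‖ ^ 2) * max 1 ‖ξ‖ ^ (-(n / 2 : ℝ))) := by ring
    _ ≤ C * (2 * ε) * (Real.exp 1 * ∑ j ∈ Finset.range (J + 1),
        ((2 : ℝ) ^ j) ^ (-(n / 2 : ℝ)) * Real.exp (-(4 * ((2 : ℝ) ^ j) ^ 2)⁻¹ * ‖ξ‖ ^ 2)) := by
        refine mul_le_mul_of_nonneg_left ?_ (by positivity)
        refine gaussian_mul_max_rpow_le_sum_two_pow (by positivity) (by positivity) ?_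
          (norm_nonneg ξ)
        rw [← inv_pow]
        gcongr
    _ = _ := by simp only [Finset.mul_sum]; refine Finset.sum_congr rfl fun j _ => ?_; ring

theorem sq_rpow_natCast_div_two {x : ℝ} (hx : 0 ≤ x) (d : ℕ) :
    (x ^ 2) ^ ((d : ℝ) / 2) = x ^ d := by
  rw [← Real.rpow_natCast x 2, ← Real.rpow_mul hx, ← Real.rpow_natCast x d]
  congr 1
  push_cast
  ring

theorem exists_integral_gaussian_conv_annulus_le (n : ℕ) (α : ℝ) :
    ∃ C : ℝ, 0 ≤ C ∧ ∀ (μ : Measure (EuclideanSpace ℝ (Fin (n + 1)))) [IsFiniteMeasure μ] (A : ℝ),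
      0 ≤ A → ∀ ε : ℝ, 0 < ε → ε < 1 / 2 →
      (∀ x R, ε ≤ 2 * R → μ (Metric.ball x R) ≤ ENNReal.ofReal (A * R ^ α)) →
      ∀ J : ℕ, ε⁻¹ ≤ 2 ^ J → (2 : ℝ) ^ J ≤ 2 * ε⁻¹ →
        ∫ w, Real.exp (-(ε ^ 2)⁻¹ * ‖w‖ ^ 2)
            ∂(Measure.conv (diffMeasure μ) (volume.restrict (annulus (n + 1) (2 * ε)))) ≤
          C * A * μ.real Set.univ * ε ^ (n + 2) *
            ∑ j ∈ Finset.range (J + 1), ((2 : ℝ) ^ j) ^ ((n : ℝ) / 2 + 1 - α) := by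
  obtain ⟨C, hC0, hC⟩ := exists_gaussian_mul_norm_charFun_annulus_le_sum n
  set T := ∑' m : ℕ, Real.exp (-m) * ((m : ℝ) + 1) ^ α
  have : 0 ≤ T := tsum_nonneg fun m => by positivity
  refine ⟨C * T, by positivity, fun μ _ A hA ε hε hε2 hμ J hJ hJ' => ?_⟩
  have h := integral_gaussian_diffMeasure_conv_le (μ := μ) (s := Finset.range (J + 1))
    (inv_pos.2 (pow_pos hε 2)) (β := fun j => ((2 : ℝ) ^ j) ^ 2) (fun j _ => by positivity)
    (hC ε hε hε2 J hJ)
  simp only [finrank_euclideanSpace_fin] at h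
  rw [← inv_pow, sq_rpow_natCast_div_two (by positivity), inv_pow, inv_pow,
    inv_mul_le_iff₀ (by positivity)] at h
  refine h.trans ?_
  rw [Finset.mul_sum, Finset.mul_sum]
  refine Finset.sum_le_sum fun j hj => ?_
  have h2j : (0 : ℝ) < 2 ^ j := by positivity
  have hscale : ε ≤ 2 * ((2 : ℝ) ^ j)⁻¹ := by
    have : (2 : ℝ) ^ j ≤ 2 * ε⁻¹ :=
      (pow_le_pow_right₀ one_le_two (Finset.mem_range_succ_iff.1 hj)).trans hJ'
    rw [← div_eq_mul_inv] at this ⊢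
    exact (le_div_comm₀ h2j hε).1 this
  have hG := integral_gaussian_diffMeasure_le (μ := μ) hA (inv_pos.2 h2j)
    fun x R hR => hμ x R (by linarith)
  rw [inv_pow, inv_inv] at hG
  rw [sq_rpow_natCast_div_two h2j.le]
  have hpow : ((2 : ℝ) ^ j) ^ ((n : ℝ) / 2 + 1 - α) =
      ((2 : ℝ) ^ j) ^ (-(n / 2 : ℝ)) * ((2 : ℝ) ^ j) ^ (n + 1) * (((2 : ℝ) ^ j)⁻¹) ^ α := by
    rw [Real.inv_rpow h2j.le, ← Real.rpow_neg h2j.le, ← Real.rpow_natCast _ (n + 1),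
      ← Real.rpow_add h2j, ← Real.rpow_add h2j]
    congr 1; push_cast; ring
  rw [hpow]
  calc _ ≤ ε ^ (n + 1) * (C * ε * ((2 : ℝ) ^ j) ^ (-(n / 2 : ℝ)) * (((2 : ℝ) ^ j) ^ (n + 1) *
        (A * (((2 : ℝ) ^ j)⁻¹) ^ α * T * μ.real Set.univ))) := by gcongr
    _ = _ := by ring

theorem exists_sum_two_pow_rpow_le {e η : ℝ} (hη : 0 < η) (he : e ≤ η) :
    ∃ C : ℝ, 0 ≤ C ∧ ∀ (t : ℝ) (J : ℕ), (2 : ℝ) ^ J ≤ t →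
      ∑ j ∈ Finset.range (J + 1), ((2 : ℝ) ^ j) ^ e ≤ C * t ^ η := by
  have hq1 : 1 < (2 : ℝ) ^ η := Real.one_lt_rpow one_lt_two hη
  have : 0 < (2 : ℝ) ^ η - 1 := by linarith
  have hcomm (j : ℕ) : ((2 : ℝ) ^ j) ^ η = ((2 : ℝ) ^ η) ^ j :=
    Real.rpow_pow_comm zero_le_two η j ▸ rfl
  refine ⟨2 ^ η / (2 ^ η - 1), by positivity, fun t J hJ => ?_⟩
  calc _ ≤ ∑ j ∈ Finset.range (J + 1), ((2 : ℝ) ^ η) ^ j := by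
        gcongr with j
        rw [← hcomm]
        exact Real.rpow_le_rpow_of_exponent_le (one_le_pow₀ one_le_two) he
    _ = (((2 : ℝ) ^ η) ^ (J + 1) - 1) / (2 ^ η - 1) := geom_sum_eq hq1.ne' _
    _ ≤ 2 ^ η * t ^ η / (2 ^ η - 1) := by
        gcongr
        rw [← hcomm, pow_succ', Real.mul_rpow zero_le_two (by positivity)]
        have : ((2 : ℝ) ^ J) ^ η ≤ t ^ η := by gcongr
        nlinarith
    _ = _ := by ring

theorem exists_diffMeasure_real_le (n : ℕ) {α η : ℝ} (hη : 0 < η) (hαη : (n : ℝ) / 2 + 1 - α ≤ η) :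
    ∃ C : ℝ, 0 ≤ C ∧ ∀ (μ : Measure (EuclideanSpace ℝ (Fin (n + 1)))) [IsFiniteMeasure μ] (A : ℝ),
      0 ≤ A → ∀ ε : ℝ, 0 < ε → ε < 1 / 2 →
      (∀ x R, ε ≤ 2 * R → μ (Metric.ball x R) ≤ ENNReal.ofReal (A * R ^ α)) →
      (diffMeasure μ).real {w | |‖w‖ - 1| < ε} ≤ C * A * μ.real Set.univ * ε ^ (1 - η) := by
  obtain ⟨C₁, hC₁0, hC₁⟩ := exists_integral_gaussian_conv_annulus_le n α
  obtain ⟨C₂, hC₂0, hC₂⟩ := exists_sum_two_pow_rpow_le hη hαη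
  set v := volume.real (Metric.ball (0 : EuclideanSpace ℝ (Fin (n + 1))) 1)
  have hv : 0 < v := ENNReal.toReal_pos (Metric.measure_ball_pos _ _ one_pos).ne'
    measure_ball_lt_top.ne
  refine ⟨C₁ * C₂ * 2 ^ η / (Real.exp (-1) * v), by positivity, fun μ _ A hA ε hε hε2 hμ => ?_⟩
  set S : Set (EuclideanSpace ℝ (Fin (n + 1))) := {w | |‖w‖ - 1| < ε}
  obtain ⟨i, hi, hi'⟩ := exists_nat_pow_near ((one_le_inv₀ hε).2 (by linarith))
    (one_lt_two (α := ℝ))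
  have hJ : (2 : ℝ) ^ (i + 1) ≤ 2 * ε⁻¹ := by rw [pow_succ']; gcongr
  have hupper := (hC₁ μ A hA ε hε hε2 hμ (i + 1) hi'.le hJ).trans
    (mul_le_mul_of_nonneg_left (hC₂ _ _ hJ) (by positivity))
  have hball : ∀ w ∈ S, ε ^ (n + 1) * v ≤
      (volume.restrict (annulus (n + 1) (2 * ε))).real (Metric.ball (-w) ε) := fun w hw => by
    rw [measureReal_restrict_apply measurableSet_ball,
      Set.inter_eq_left.2 (ball_neg_subset_annulus hw), ← volume_real_ball hε,
      measureReal_def, measureReal_def, Measure.addHaar_ball_center _ (-w)]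
  have hlower := exp_neg_one_mul_mul_measureReal_le_integral_conv (κ := diffMeasure μ)
    (measurableSet_lt (by fun_prop) measurable_const) hε hball
  have hpow : ε ^ (n + 2) * (2 * ε⁻¹) ^ η = ε ^ (n + 1) * (2 ^ η * ε ^ (1 - η)) := by
    rw [Real.mul_rpow zero_le_two (by positivity), Real.inv_rpow hε.le, Real.rpow_sub hε,
      Real.rpow_one]
    ring
  have hX : 0 < Real.exp (-1) * (ε ^ (n + 1) * v) := by positivity
  refine le_of_mul_le_mul_left ((hlower.trans hupper).trans_eq ?_) hX
  calc _ = C₁ * A * μ.real Set.univ * C₂ * (ε ^ (n + 2) * (2 * ε⁻¹) ^ η) := by ring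
    _ = _ := by rw [hpow]; field_simp

theorem thickening_unitPairs_subset {d : ℕ} (K : Set (EuclideanSpace ℝ (Fin d))) (δ : ℝ) :
    Metric.thickening δ (unitPairs K) ⊆
      {p | |‖p.1 - p.2‖ - 1| < 2 * δ} ∩ Metric.thickening δ K ×ˢ Metric.thickening δ K := by
  rintro ⟨x, y⟩ hp
  obtain ⟨⟨k₁, k₂⟩, ⟨h1, h2, h3⟩, hd⟩ := Metric.mem_thickening_iff.1 hp
  obtain ⟨hx, hy⟩ := max_lt_iff.1 (Prod.dist_eq.symm.trans_lt hd)
  refine ⟨?_, Metric.mem_thickening_iff.2 ⟨k₁, h1, hx⟩, Metric.mem_thickening_iff.2 ⟨k₂, h2, hy⟩⟩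
  calc |‖x - y‖ - 1| = |‖x - y‖ - ‖k₁ - k₂‖| := by rw [← h3, norm_sub_rev k₂ k₁]
    _ ≤ ‖(x - y) - (k₁ - k₂)‖ := abs_norm_sub_norm_le _ _
    _ = ‖(x - k₁) - (y - k₂)‖ := by congr 1; abel
    _ ≤ ‖x - k₁‖ + ‖y - k₂‖ := norm_sub_le _ _
    _ < 2 * δ := by rw [← dist_eq_norm, ← dist_eq_norm]; dsimp only at hx hy; linarith

theorem volume_thickening_unitPairs_le {d : ℕ} (K : Set (EuclideanSpace ℝ (Fin d))) {δ : ℝ}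
    (hfin : volume (Metric.thickening δ K) < ⊤) :
    volume (Metric.thickening δ (unitPairs K)) ≤
      diffMeasure (volume.restrict (Metric.thickening δ K)) {w | |‖w‖ - 1| < 2 * δ} := by
  have := isFiniteMeasure_restrict.2 hfin.ne
  have hS : MeasurableSet {w : EuclideanSpace ℝ (Fin d) | |‖w‖ - 1| < 2 * δ} :=
    measurableSet_lt (by fun_prop) measurable_const
  refine (measure_mono (thickening_unitPairs_subset K δ)).trans_eq ?_
  rw [diffMeasure_apply _ hS, Measure.prod_restrict, ← Measure.volume_eq_prod]
  exact (Measure.restrict_apply ((measurable_fst.sub measurable_snd) hS)).symm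

section DiscreteSet

variable {d : ℕ} {α : ℝ} {K : Set (EuclideanSpace ℝ (Fin d))}

theorem IsDiscreteAlphaSet.exists_nonneg (h : IsDiscreteAlphaSet α K) :
    ∃ C : ℝ, 0 ≤ C ∧ ∀ δ : ℝ, 0 < δ → δ ≤ 1 → ∀ (x : EuclideanSpace ℝ (Fin d)) (r : ℝ), δ ≤ r →
      volume (Metric.thickening δ K ∩ Metric.ball x r) ≤
        ENNReal.ofReal (C * δ ^ ((d : ℝ) - α) * r ^ α) := by
  obtain ⟨C, hC⟩ := h
  refine ⟨max C 0, le_max_right _ _, fun δ h0 h1 x r hr => (hC δ h0 h1 x r hr).trans ?_⟩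
  have hr0 : 0 ≤ r := h0.le.trans hr
  rw [mul_assoc]
  calc ENNReal.ofReal (C * ((r / δ) ^ α * δ ^ d))
      ≤ ENNReal.ofReal (max C 0 * ((r / δ) ^ α * δ ^ d)) := by gcongr; exact le_max_left _ _
    _ = _ := by
      rw [Real.div_rpow hr0 h0.le, Real.rpow_sub h0, Real.rpow_natCast]
      congr 1
      ring

theorem IsDiscreteAlphaSet.exists_volume_thickening_le (h : IsDiscreteAlphaSet α K)
    (hK : Bornology.IsBounded K) :
    ∃ C : ℝ, 0 ≤ C ∧ ∀ δ : ℝ, 0 < δ → δ ≤ 1 →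
      volume (Metric.thickening δ K) ≤ ENNReal.ofReal (C * δ ^ ((d : ℝ) - α)) := by
  obtain ⟨C, hC0, hC⟩ := h.exists_nonneg
  obtain ⟨R, hR1, hR⟩ := hK.thickening (δ := 1) |>.subset_ball_lt 1 0
  refine ⟨C * R ^ α, by positivity, fun δ h0 h1 => ?_⟩
  have hball := hC δ h0 h1 0 R (h1.trans hR1.le)
  rw [Set.inter_eq_left.2 ((Metric.thickening_mono h1 K).trans hR)] at hball
  exact hball.trans_eq (by ring_nf)

end DiscreteSet

theorem IsDiscreteAlphaSet.exists_volume_thickening_unitPairs_le {n : ℕ} {α s : ℝ}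
    {K : Set (EuclideanSpace ℝ (Fin (n + 1)))} (h : IsDiscreteAlphaSet α K)
    (hK : Bornology.IsBounded K) (hs₁ : 2 * α - 1 < s) (hs₂ : α + n / 2 ≤ s) :
    ∃ C : ℝ, 0 ≤ C ∧ ∀ δ : ℝ, 0 < δ → δ < 1 / 4 →
      volume (Metric.thickening δ (unitPairs K)) ≤
        ENNReal.ofReal (C * δ ^ (2 * ((n : ℝ) + 1) - s)) := by
  obtain ⟨C₁, hC₁0, hC₁⟩ := h.exists_nonneg
  obtain ⟨C₂, hC₂0, hC₂⟩ := h.exists_volume_thickening_le hK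
  obtain ⟨C₃, hC₃0, hC₃⟩ := exists_diffMeasure_real_le n (α := α) (sub_pos.2 hs₁)
    (by linarith)
  set η := s - (2 * α - 1) with hη
  refine ⟨C₃ * C₁ * C₂ * 2 ^ (1 - η), by positivity, fun δ hδ hδ4 => ?_⟩
  have hvol := hC₂ δ hδ (by linarith)
  have hfin := hvol.trans_lt ENNReal.ofReal_lt_top
  set μ := volume.restrict (Metric.thickening δ K) with hμ
  have : IsFiniteMeasure μ := isFiniteMeasure_restrict.2 hfin.ne
  have hmass : μ.real Set.univ ≤ C₂ * δ ^ (((n + 1 : ℕ) : ℝ) - α) := by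
    rw [hμ, measureReal_restrict_apply_univ]
    exact ENNReal.toReal_le_of_le_ofReal (by positivity) hvol
  have hball : ∀ x R, 2 * δ ≤ 2 * R → μ (Metric.ball x R) ≤
      ENNReal.ofReal (C₁ * δ ^ (((n + 1 : ℕ) : ℝ) - α) * R ^ α) := fun x R hR => by
    rw [hμ, Measure.restrict_apply measurableSet_ball, Set.inter_comm]
    exact hC₁ δ hδ (by linarith) x R (by linarith)
  refine (volume_thickening_unitPairs_le K hfin).trans ?_
  rw [← ofReal_measureReal]
  refine ENNReal.ofReal_le_ofReal ?_
  calc _ ≤ C₃ * (C₁ * δ ^ (((n + 1 : ℕ) : ℝ) - α)) * μ.real Set.univ * (2 * δ) ^ (1 - η) :=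
        hC₃ μ _ (by positivity) (2 * δ) (by linarith) (by linarith) hball
    _ ≤ C₃ * (C₁ * δ ^ (((n + 1 : ℕ) : ℝ) - α)) * (C₂ * δ ^ (((n + 1 : ℕ) : ℝ) - α)) *
        (2 * δ) ^ (1 - η) := by gcongr
    _ = C₃ * C₁ * C₂ * 2 ^ (1 - η) *
        (δ ^ (((n + 1 : ℕ) : ℝ) - α) * δ ^ (((n + 1 : ℕ) : ℝ) - α) * δ ^ (1 - η)) := by
      rw [Real.mul_rpow zero_le_two hδ.le]; ring
    _ = _ := by
      rw [← Real.rpow_add hδ, ← Real.rpow_add hδ, hη]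
      congr 2
      push_cast
      ring

/-! ### Minkowski dimension -/

theorem sum_ediam_closedEBall_minimalCover_le {X : Type*} [EMetricSpace X] {A : Set X}
    {ε : NNReal} [Fintype (Metric.minimalCover ε A)] (hε : Metric.coveringNumber ε A ≠ ⊤)
    {s : ℝ} (hs : 0 ≤ s) :
    ∑ c : Metric.minimalCover ε A, Metric.ediam (Metric.closedEBall (c : X) ε) ^ s ≤
      2 ^ s * ((Metric.coveringNumber ε A : ℝ≥0∞) * (ε : ℝ≥0∞) ^ s) := by
  calc ∑ c : Metric.minimalCover ε A, Metric.ediam (Metric.closedEBall (c : X) ε) ^ s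
      ≤ ∑ _ : Metric.minimalCover ε A, (2 * (ε : ℝ≥0∞)) ^ s := by
        gcongr; exact Metric.ediam_closedEBall_le
    _ = 2 ^ s * ((Metric.coveringNumber ε A : ℝ≥0∞) * (ε : ℝ≥0∞) ^ s) := by
        rw [← tsum_fintype (L := .unconditional _), ENNReal.tsum_set_const,
          Metric.encard_minimalCover hε, ENNReal.mul_rpow_of_nonneg _ _ hs, mul_left_comm]

theorem dimH_le_of_frequently_coveringNumber_le {X : Type*} [EMetricSpace X] {A : Set X}
    {s : NNReal} {C : ℝ≥0∞} (hC : C ≠ ⊤)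
    (h : ∃ᶠ ε in 𝓝[>] (0 : NNReal),
      (Metric.coveringNumber ε A : ℝ≥0∞) * (ε : ℝ≥0∞) ^ (s : ℝ) ≤ C) :
    dimH A ≤ s := by
  borelize X
  obtain ⟨l, hl, hl0, hcov⟩ : ∃ l : Filter NNReal, l.NeBot ∧ l ≤ 𝓝[>] 0 ∧ ∀ᶠ ε in l,
      (Metric.coveringNumber ε A : ℝ≥0∞) * (ε : ℝ≥0∞) ^ (s : ℝ) ≤ C :=
    ⟨_, Filter.frequently_iff_neBot.1 h, inf_le_left, Filter.eventually_inf_principal.2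
      (Filter.Eventually.of_forall fun _ => id)⟩
  have hfinite : ∀ᶠ ε in l, Metric.coveringNumber ε A ≠ ⊤ := by
    filter_upwards [hcov, hl0 self_mem_nhdsWithin] with ε hε hpos htop
    rw [htop, ENat.toENNReal_top, ENNReal.top_mul] at hε
    · exact hC (top_le_iff.1 hε)
    · exact (ENNReal.rpow_pos (ENNReal.coe_pos.2 hpos) ENNReal.coe_ne_top).ne'
  have (ε : NNReal) : Fintype (Metric.minimalCover ε A) := Metric.finite_minimalCover.fintype
  have htendsto : Filter.Tendsto (fun ε : NNReal => 2 * (ε : ℝ≥0∞)) l (𝓝 0) := by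
    have h2 : Filter.Tendsto (fun ε : NNReal => ((2 * ε : NNReal) : ℝ≥0∞)) (𝓝 0) (𝓝 0) := by
      simpa using ENNReal.tendsto_coe.2 ((continuous_const_mul (2 : NNReal)).tendsto 0)
    simpa using h2.mono_left (hl0.trans nhdsWithin_le_nhds)
  refine dimH_le_of_hausdorffMeasure_ne_top
    (ne_top_of_le_ne_top (b := 2 ^ (s : ℝ) * C) (by finiteness) ?_)
  refine (Measure.hausdorffMeasure_le_liminf_sum (s : ℝ) A _ htendsto
    (fun ε (c : Metric.minimalCover ε A) => Metric.closedEBall (c : X) ε)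
    (Filter.Eventually.of_forall fun ε c => Metric.ediam_closedEBall_le) ?_).trans ?_
  · filter_upwards [hfinite] with ε hε
    rw [← Set.biUnion_eq_iUnion _ fun c _ => Metric.closedEBall c (ε : ℝ≥0∞)]
    exact Metric.isCover_iff_subset_iUnion_closedEBall.1 (Metric.isCover_minimalCover hε)
  · refine Filter.liminf_le_of_frequently_le' (Filter.Eventually.frequently ?_)
    filter_upwards [hfinite, hcov] with ε hε hcov
    exact (sum_ediam_closedEBall_minimalCover_le hε s.coe_nonneg).trans (by gcongr)

section Volume

variable {E : Type*} [NormedAddCommGroup E] [MeasureSpace E] [BorelSpace E]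
  [(volume : Measure E).IsAddHaarMeasure]

theorem packingNumber_mul_volume_ball_le (A : Set E) (ε : NNReal) :
    (Metric.packingNumber ε A : ℝ≥0∞) * volume (Metric.ball (0 : E) (ε / 2)) ≤
      volume (Metric.thickening (ε / 2) A) := by
  simp only [Metric.packingNumber, ENat.toENNReal_iSup, ENNReal.iSup_mul, iSup_le_iff]
  intro S hSA hS
  have hdisjoint : Pairwise (Function.onFun Disjoint fun c : S =>
      Metric.ball (c : E) (ε / 2)) := fun x y hxy => by
    refine Metric.ball_disjoint_ball ?_
    have hsep : (ε : ℝ≥0∞) < edist (x : E) y := hS x.2 y.2 (Subtype.coe_ne_coe.2 hxy)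
    rw [edist_nndist, ENNReal.coe_lt_coe, ← NNReal.coe_lt_coe, coe_nndist] at hsep
    linarith
  calc (S.encard : ℝ≥0∞) * volume (Metric.ball (0 : E) (ε / 2))
      = ∑' c : S, volume (Metric.ball (c : E) (ε / 2)) := by
        rw [← ENNReal.tsum_set_const]
        exact tsum_congr fun c => (Measure.addHaar_ball_center _ _ _).symm
    _ ≤ volume (⋃ c : S, Metric.ball (c : E) (ε / 2)) :=
        tsum_meas_le_meas_iUnion_of_disjoint _ (fun _ => measurableSet_ball) hdisjoint
    _ ≤ volume (Metric.thickening (ε / 2) A) :=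
        measure_mono <| Set.iUnion_subset fun c => Metric.ball_subset_thickening (hSA c.2) _

theorem coveringNumber_mul_rpow_le [NormedSpace ℝ E] [FiniteDimensional ℝ E] {A : Set E} {s : ℝ}
    {ε : NNReal} (hε : 0 < ε) (h : volume (Metric.thickening (ε / 2) A) ≤
      ENNReal.ofReal (((ε : ℝ) / 2) ^ ((Module.finrank ℝ E : ℝ) - s))) :
    (Metric.coveringNumber ε A : ℝ≥0∞) * (ε : ℝ≥0∞) ^ s ≤
      ENNReal.ofReal (2 ^ s) * (volume (Metric.ball (0 : E) 1))⁻¹ := by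
  set N : ℝ≥0∞ := (Metric.coveringNumber ε A : ℝ≥0∞)
  set v := volume (Metric.ball (0 : E) 1)
  set n := Module.finrank ℝ E
  have hδ : (0 : ℝ) < ε / 2 := by positivity
  have hvol : N * (ENNReal.ofReal ((ε / 2 : ℝ) ^ n) * v) ≤
      ENNReal.ofReal (((ε : ℝ) / 2) ^ ((n : ℝ) - s)) := by
    rw [← Measure.addHaar_ball_of_pos _ (0 : E) hδ]
    refine le_trans ?_ ((packingNumber_mul_volume_ball_le A ε).trans h)
    gcongr
    exact ENat.toENNReal_le.2 (Metric.coveringNumber_le_packingNumber ε A)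
  have hsplit : ENNReal.ofReal ((ε / 2 : ℝ) ^ ((n : ℝ) - s)) =
      ENNReal.ofReal ((ε / 2 : ℝ) ^ n) * ENNReal.ofReal ((ε / 2 : ℝ) ^ (-s)) := by
    rw [← ENNReal.ofReal_mul (by positivity), sub_eq_add_neg, Real.rpow_add hδ, Real.rpow_natCast]
  rw [hsplit, mul_left_comm, ENNReal.mul_le_mul_iff_right
    (ENNReal.ofReal_pos.2 (pow_pos hδ n)).ne' ENNReal.ofReal_ne_top] at hvol
  have hN : N ≤ ENNReal.ofReal ((ε / 2 : ℝ) ^ (-s)) * v⁻¹ := by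
    rw [← div_eq_mul_inv, ENNReal.le_div_iff_mul_le
      (Or.inl (Metric.measure_ball_pos _ _ one_pos).ne') (Or.inl measure_ball_lt_top.ne)]
    exact hvol
  calc N * (ε : ℝ≥0∞) ^ s ≤ ENNReal.ofReal ((ε / 2 : ℝ) ^ (-s)) * v⁻¹ * (ε : ℝ≥0∞) ^ s := by gcongr
    _ = ENNReal.ofReal ((ε / 2 : ℝ) ^ (-s) * (ε : ℝ) ^ s) * v⁻¹ := by
        rw [mul_right_comm, ENNReal.ofReal_mul (by positivity),
          ← ENNReal.ofReal_rpow_of_pos (NNReal.coe_pos.2 hε), ENNReal.ofReal_coe_nnreal]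
    _ = _ := by
        rw [Real.rpow_neg hδ.le, Real.div_rpow ε.coe_nonneg zero_le_two]
        have := (Real.rpow_pos_of_pos (NNReal.coe_pos.2 hε) s).ne'
        field_simp

end Volume

section Minkowski

theorem sub_log_div_log_le_iff {V : ℝ≥0∞} {δ n s : ℝ} (hδ : 0 < δ) (hδ1 : δ < 1) :
    (n : EReal) - ENNReal.log V / (Real.log δ : EReal) ≤ s ↔ V ≤ ENNReal.ofReal (δ ^ (n - s)) := by
  have hlog := Real.log_neg hδ hδ1
  have hanti := EReal.strictAnti_div_right_of_neg (EReal.coe_neg'.2 hlog) (EReal.coe_ne_bot _)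
  have hdiv : ENNReal.log (ENNReal.ofReal (δ ^ (n - s))) / (Real.log δ : EReal) =
      ((n - s : ℝ) : EReal) := by
    rw [ENNReal.log_ofReal_of_pos (by positivity), Real.log_rpow hδ, ← EReal.coe_div,
      mul_div_cancel_right₀ _ hlog.ne]
  rw [← ENNReal.log_le_log_iff, ← hanti.le_iff_ge (a := ENNReal.log (ENNReal.ofReal (δ ^ (n - s)))),
    hdiv, EReal.coe_sub,
    EReal.sub_le_iff_le_add (.inr (EReal.coe_ne_top s)) (.inr (EReal.coe_ne_bot s)),
    EReal.sub_le_iff_le_add (.inl (EReal.coe_ne_bot s)) (.inl (EReal.coe_ne_top s)), add_comm]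

variable {E : Type*} [NormedAddCommGroup E] [NormedSpace ℝ E] [MeasureSpace E] {A : Set E}

theorem upperMinkowskiDim_le_of_forall_gt {s₀ : ℝ}
    (h : ∀ s, s₀ < s → ∃ C : ℝ, ∀ᶠ δ in 𝓝[>] (0 : ℝ), volume (Metric.thickening δ A) ≤
      ENNReal.ofReal (C * δ ^ ((Module.finrank ℝ E : ℝ) - s))) :
    upperMinkowskiDim A ≤ (s₀ : EReal) := by
  refine EReal.le_of_forall_lt_iff_le.1 fun z hz => ?_
  obtain ⟨s, hs₀s, hsz⟩ := exists_between (EReal.coe_lt_coe_iff.1 hz)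
  obtain ⟨C, hC⟩ := h s hs₀s
  refine Filter.limsup_le_of_le (by isBoundedDefault) ?_
  have htendsto : Filter.Tendsto (fun δ : ℝ => C * δ ^ (z - s)) (𝓝[>] 0) (𝓝 0) := by
    have h0 := (Real.continuousAt_rpow_const 0 (z - s) (Or.inr (by linarith))).tendsto
    rw [Real.zero_rpow (by linarith)] at h0
    simpa using (h0.mono_left nhdsWithin_le_nhds).const_mul C
  filter_upwards [hC, htendsto.eventually (eventually_le_nhds one_pos),
    Ioo_mem_nhdsGT one_pos] with δ hvol hsmall ⟨hδ, hδ1⟩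
  rw [sub_log_div_log_le_iff hδ hδ1]
  refine hvol.trans (ENNReal.ofReal_le_ofReal ?_)
  calc C * δ ^ ((Module.finrank ℝ E : ℝ) - s)
      = C * δ ^ (z - s) * δ ^ ((Module.finrank ℝ E : ℝ) - z) := by
        rw [mul_assoc, ← Real.rpow_add hδ]; congr 2; ring
    _ ≤ 1 * δ ^ ((Module.finrank ℝ E : ℝ) - z) := by gcongr
    _ = _ := one_mul _

theorem eventually_volume_thickening_le {s : ℝ} (h : upperMinkowskiDim A < s) :
    ∀ᶠ δ in 𝓝[>] (0 : ℝ), volume (Metric.thickening δ A) ≤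
      ENNReal.ofReal (δ ^ ((Module.finrank ℝ E : ℝ) - s)) := by
  filter_upwards [Filter.eventually_lt_of_limsup_lt h, Ioo_mem_nhdsGT one_pos]
    with δ hlt ⟨hδ, hδ1⟩
  exact (sub_log_div_log_le_iff hδ hδ1).1 hlt.le

variable [FiniteDimensional ℝ E] [BorelSpace E] [(volume : Measure E).IsAddHaarMeasure]

theorem dimH_le_of_upperMinkowskiDim_lt {s : NNReal} (h : upperMinkowskiDim A < (s : ℝ)) :
    dimH A ≤ s := by
  have hhalf : Filter.Tendsto (fun ε : NNReal => (ε : ℝ) / 2) (𝓝[>] 0) (𝓝[>] 0) := by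
    refine tendsto_nhdsWithin_iff.2 ⟨?_, ?_⟩
    · exact ((by fun_prop : Continuous fun ε : NNReal => (ε : ℝ) / 2).tendsto' 0 0
        (by simp)).mono_left nhdsWithin_le_nhds
    · filter_upwards [self_mem_nhdsWithin] with ε hε using half_pos (NNReal.coe_pos.2 hε)
  refine dimH_le_of_frequently_coveringNumber_le
    (C := ENNReal.ofReal (2 ^ (s : ℝ)) * (volume (Metric.ball (0 : E) 1))⁻¹)
    (ENNReal.mul_ne_top ENNReal.ofReal_ne_top
      (ENNReal.inv_ne_top.2 (Metric.measure_ball_pos _ _ one_pos).ne'))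
    (Filter.Eventually.frequently ?_)
  filter_upwards [hhalf.eventually (eventually_volume_thickening_le h), self_mem_nhdsWithin]
    with ε hvol hε using coveringNumber_mul_rpow_le hε hvol

theorem dimH_le_of_upperMinkowskiDim_le {s : ℝ} (hs : 0 ≤ s) (h : upperMinkowskiDim A ≤ s) :
    dimH A ≤ ENNReal.ofReal s := by
  refine le_of_forall_gt_imp_ge_of_dense fun b hb => ?_
  obtain ⟨t, hst, htb⟩ := ENNReal.lt_iff_exists_nnreal_btwn.1 hb
  rw [ENNReal.ofReal_lt_coe_iff hs] at hst
  exact (dimH_le_of_upperMinkowskiDim_lt (h.trans_lt (EReal.coe_lt_coe_iff.2 hst))).trans htb.le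

end Minkowski

instance (d : ℕ) : (volume : Measure (EuclideanSpace ℝ (Fin d) ×
    EuclideanSpace ℝ (Fin d))).IsAddHaarMeasure :=
  inferInstanceAs (Measure.prod volume volume).IsAddHaarMeasure

section UpperBound

variable {d : ℕ} {α : ℝ} {K : Set (EuclideanSpace ℝ (Fin d))}

theorem IsDiscreteAlphaSet.upperMinkowskiDim_le (h : IsDiscreteAlphaSet α K)
    (hK : Bornology.IsBounded K) : upperMinkowskiDim K ≤ α := by
  obtain ⟨C, hC0, hC⟩ := h.exists_volume_thickening_le hK
  refine upperMinkowskiDim_le_of_forall_gt fun s hs => ⟨C, ?_⟩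
  filter_upwards [Ioo_mem_nhdsGT one_pos] with δ ⟨hδ, hδ1⟩
  refine (hC δ hδ hδ1.le).trans ?_
  rw [finrank_euclideanSpace_fin]
  gcongr ENNReal.ofReal (C * ?_)
  exact Real.rpow_le_rpow_of_exponent_ge hδ hδ1.le (by linarith)

theorem IsDiscreteAlphaSet.upperMinkowskiDim_unitPairs_le (hd : 1 ≤ d)
    (h : IsDiscreteAlphaSet α K) (hK : Bornology.IsBounded K) :
    upperMinkowskiDim (unitPairs K) ≤ (max (2 * α - 1) (α + ((d : ℝ) - 1) / 2) : ℝ) := by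
  obtain ⟨n, rfl⟩ := Nat.exists_eq_add_of_le' hd
  refine upperMinkowskiDim_le_of_forall_gt fun s hs => ?_
  obtain ⟨hs₁, hs₂⟩ := max_lt_iff.1 hs
  rw [Nat.cast_add_one, add_sub_cancel_right] at hs₂
  obtain ⟨C, -, hC⟩ := h.exists_volume_thickening_unitPairs_le hK hs₁ hs₂.le
  refine ⟨C, ?_⟩
  filter_upwards [Ioo_mem_nhdsGT (by norm_num : (0 : ℝ) < 1 / 4)] with δ ⟨hδ, hδ4⟩
  rw [Module.finrank_prod, finrank_euclideanSpace_fin]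
  convert hC δ hδ hδ4 using 4
  push_cast
  ring

theorem g_le (hd : 1 ≤ d) (hα : 0 ≤ α) :
    g d α ≤ ENNReal.ofReal (max (2 * α - 1) (α + ((d : ℝ) - 1) / 2)) := by
  have hd' : (1 : ℝ) ≤ d := Nat.one_le_cast.2 hd
  refine sSup_le ?_
  rintro _ ⟨K, hK, rfl⟩
  exact dimH_le_of_upperMinkowskiDim_le (le_max_of_le_right (by linarith))
    (hK.isDiscreteAlphaSet.upperMinkowskiDim_unitPairs_le hd hK.isCompact.isBounded)

end UpperBound

/-! ### Ahlfors regular sets -/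

/-- `S` is Ahlfors regular of dimension `s`, as witnessed by `ν`: a finite measure charging `S`,
with `ν (B(x, r)) ≲ r^s` for all `x`, and `ν (B(x, r)) ≳ r^s` for `x ∈ S` and `r ≤ 1`. -/
structure IsAhlforsRegular {X : Type*} [PseudoMetricSpace X] [MeasurableSpace X] (s : ℝ)
    (S : Set X) (ν : Measure X) : Prop where
  isFiniteMeasure : IsFiniteMeasure ν
  measure_ne_zero : ν S ≠ 0
  upper : ∃ C : ℝ, 0 < C ∧ ∀ (x : X) (r : ℝ), 0 < r →
    ν (Metric.closedBall x r) ≤ ENNReal.ofReal (C * r ^ s)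
  lower : ∃ c : ℝ, 0 < c ∧ ∀ x ∈ S, ∀ r : ℝ, 0 < r → r ≤ 1 →
    ENNReal.ofReal (c * r ^ s) ≤ ν (Metric.closedBall x r)

section MassDistribution

theorem measure_le_mul_diam_rpow {X : Type*} [PseudoMetricSpace X] [MeasurableSpace X]
    {ν : Measure X} {s C : ℝ} (hs : 0 ≤ s)
    (h : ∀ (x : X) (r : ℝ), 0 < r → ν (Metric.closedBall x r) ≤ ENNReal.ofReal (C * r ^ s))
    {U : Set X} (hU : U.Nonempty) (hbdd : Bornology.IsBounded U) :
    ν U ≤ ENNReal.ofReal (C * Metric.diam U ^ s) := by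
  obtain ⟨x, hx⟩ := hU
  have htendsto : Filter.Tendsto (fun t : ℝ => ENNReal.ofReal (C * t ^ s)) (𝓝[>] Metric.diam U)
      (𝓝 (ENNReal.ofReal (C * Metric.diam U ^ s))) :=
    ENNReal.tendsto_ofReal (((Real.continuousAt_rpow_const _ s (Or.inr hs)).tendsto.mono_left
      nhdsWithin_le_nhds).const_mul C)
  refine ge_of_tendsto htendsto ?_
  filter_upwards [self_mem_nhdsWithin] with t (ht : Metric.diam U < t)
  exact (measure_mono fun y hy => (Metric.dist_le_diam_of_mem hbdd hy hx).trans ht.le).trans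
    (h x t (Metric.diam_nonneg.trans_lt ht))

variable {X : Type*} [MetricSpace X] [MeasurableSpace X] [BorelSpace X] {ν : Measure X} {s : ℝ}

theorem inv_smul_le_hausdorffMeasure {C : ℝ} (hs : 0 ≤ s) (hC : 0 < C)
    (h : ∀ (x : X) (r : ℝ), 0 < r → ν (Metric.closedBall x r) ≤ ENNReal.ofReal (C * r ^ s)) :
    (ENNReal.ofReal C)⁻¹ • ν ≤ Measure.hausdorffMeasure s := by
  refine Measure.le_hausdorffMeasure s _ 1 one_pos fun U hU => ?_
  rcases U.eq_empty_or_nonempty with rfl | hne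
  · rw [measure_empty]
    exact bot_le
  have hfin : Metric.ediam U ≠ ⊤ := (hU.trans_lt ENNReal.one_lt_top).ne
  have hdiam : ENNReal.ofReal (C * Metric.diam U ^ s) =
      ENNReal.ofReal C * Metric.ediam U ^ s := by
    rw [ENNReal.ofReal_mul hC.le, ← ENNReal.ofReal_rpow_of_nonneg Metric.diam_nonneg hs,
      Metric.diam, ENNReal.ofReal_toReal hfin]
  rw [Measure.smul_apply, smul_eq_mul,
    ENNReal.inv_mul_le_iff (ENNReal.ofReal_pos.2 hC).ne' ENNReal.ofReal_ne_top, ← hdiam]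
  exact measure_le_mul_diam_rpow hs h hne (Metric.isBounded_iff_ediam_ne_top.2 hfin)

theorem IsAhlforsRegular.le_dimH {S : Set X} (h : IsAhlforsRegular s S ν) (hs : 0 ≤ s) :
    ENNReal.ofReal s ≤ dimH S := by
  obtain ⟨C, hC, hup⟩ := h.upper
  have hne : Measure.hausdorffMeasure s S ≠ 0 := by
    refine (lt_of_lt_of_le ?_ (inv_smul_le_hausdorffMeasure hs hC hup S)).ne'
    rw [Measure.smul_apply, smul_eq_mul, ENNReal.mul_pos_iff]
    exact ⟨ENNReal.inv_pos.2 ENNReal.ofReal_ne_top, pos_iff_ne_zero.2 h.measure_ne_zero⟩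
  lift s to NNReal using hs
  rw [ENNReal.ofReal_coe_nnreal]
  exact le_dimH_of_hausdorffMeasure_ne_zero hne

end MassDistribution

theorem IsAhlforsRegular.pi {ι : Type*} [Fintype ι] {X : ι → Type*}
    [∀ i, PseudoMetricSpace (X i)] [∀ i, MeasurableSpace (X i)] {γ : ι → ℝ} {S : ∀ i, Set (X i)}
    {ν : ∀ i, Measure (X i)} (h : ∀ i, IsAhlforsRegular (γ i) (S i) (ν i)) :
    IsAhlforsRegular (∑ i, γ i) (Set.univ.pi S) (Measure.pi ν) := by
  have (i : ι) : IsFiniteMeasure (ν i) := (h i).isFiniteMeasure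
  have hprod {r : ℝ} (hr : 0 < r) {C : ι → ℝ} (hC : ∀ i, 0 < C i) :
      ∏ i, ENNReal.ofReal (C i * r ^ γ i) = ENNReal.ofReal ((∏ i, C i) * r ^ ∑ i, γ i) := by
    rw [← ENNReal.ofReal_prod_of_nonneg fun i _ => mul_nonneg (hC i).le (by positivity),
      Finset.prod_mul_distrib, Real.rpow_sum_of_pos hr]
  refine ⟨inferInstance, ?_, ?_, ?_⟩
  · rw [Measure.pi_pi]
    exact Finset.prod_ne_zero_iff.2 fun i _ => (h i).measure_ne_zero
  · choose C hC hup using fun i => (h i).upper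
    refine ⟨∏ i, C i, Finset.prod_pos fun i _ => hC i, fun x r hr => ?_⟩
    rw [closedBall_pi x hr.le, Measure.pi_pi, ← hprod hr hC]
    exact Finset.prod_le_prod' fun i _ => hup i (x i) r hr
  · choose c hc hlow using fun i => (h i).lower
    refine ⟨∏ i, c i, Finset.prod_pos fun i _ => hc i, fun x hx r hr hr1 => ?_⟩
    rw [closedBall_pi x hr.le, Measure.pi_pi, ← hprod hr hc]
    exact Finset.prod_le_prod' fun i _ => hlow i (x i) (hx i (Set.mem_univ i)) r hr hr1

section VolumeBound

theorem lintegral_measure_closedBall {X : Type*} [PseudoMetricSpace X] [SecondCountableTopology X]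
    [MeasurableSpace X] [OpensMeasurableSpace X] (μ ν : Measure X) [SFinite μ] [SFinite ν]
    (A : Set X) (ρ : ℝ) :
    ∫⁻ z in A, ν (Metric.closedBall z ρ) ∂μ = ∫⁻ y, μ.restrict A (Metric.closedBall y ρ) ∂ν := by
  have hmeas : MeasurableSet {p : X × X | dist p.2 p.1 ≤ ρ} :=
    measurableSet_le (by fun_prop) measurable_const
  have hswap (y : X) : Metric.closedBall y ρ = (fun z => (z, y)) ⁻¹' {p | dist p.2 p.1 ≤ ρ} :=
    Set.ext fun z => Metric.mem_closedBall'
  simp_rw [hswap]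
  rw [← Measure.prod_apply_symm hmeas, Measure.prod_apply hmeas]
  simp_rw [← hswap]
  rfl

theorem mul_measure_thickening_inter_ball_le {X : Type*} [PseudoMetricSpace X]
    [SecondCountableTopology X] [MeasurableSpace X] [OpensMeasurableSpace X] {μ ν : Measure X}
    [SFinite μ] [SFinite ν] {S : Set X} {a b : ℝ≥0∞} {δ r : ℝ}
    (ha : ∀ k ∈ S, a ≤ ν (Metric.closedBall k δ))
    (hb : ∀ y, μ (Metric.closedBall y (2 * δ)) ≤ b) (hr : δ ≤ r) (x : X) :
    a * μ (Metric.thickening δ S ∩ Metric.ball x r) ≤ b * ν (Metric.closedBall x (3 * r)) := by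
  set A := Metric.thickening δ S ∩ Metric.ball x r
  have hA : MeasurableSet A := Metric.isOpen_thickening.measurableSet.inter measurableSet_ball
  calc a * μ A = ∫⁻ _ in A, a ∂μ := (setLIntegral_const _ _).symm
    _ ≤ ∫⁻ z in A, ν (Metric.closedBall z (2 * δ)) ∂μ := by
        refine setLIntegral_mono' hA fun z hz => ?_
        obtain ⟨k, hk, hzk⟩ := Metric.mem_thickening_iff.1 hz.1
        exact (ha k hk).trans (measure_mono (Metric.closedBall_subset_closedBall'
          (by rw [dist_comm]; linarith)))
    _ = ∫⁻ y, μ.restrict A (Metric.closedBall y (2 * δ)) ∂ν := lintegral_measure_closedBall ..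
    _ ≤ ∫⁻ y, (Metric.closedBall x (3 * r)).indicator (fun _ => b) y ∂ν := by
        refine lintegral_mono fun y => Set.le_indicator_apply
          (fun _ => (Measure.restrict_apply_le _ _).trans (hb y)) fun hy => ?_
        rw [Measure.restrict_apply measurableSet_closedBall]
        refine (measure_mono_null (t := ∅) ?_ measure_empty).le
        rintro z ⟨hzy, -, hzx⟩
        rw [Metric.mem_closedBall] at hzy hy
        rw [Metric.mem_ball] at hzx
        linarith [dist_triangle_left y x z]
    _ = b * ν (Metric.closedBall x (3 * r)) := by
        rw [lintegral_indicator measurableSet_closedBall, setLIntegral_const]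

theorem IsAhlforsRegular.exists_measure_thickening_inter_ball_le {E : Type*}
    [NormedAddCommGroup E] [NormedSpace ℝ E] [FiniteDimensional ℝ E] [MeasurableSpace E]
    [BorelSpace E] (μ : Measure E) [μ.IsAddHaarMeasure] {s : ℝ} {S : Set E} {ν : Measure E}
    (h : IsAhlforsRegular s S ν) :
    ∃ C : ℝ, ∀ δ : ℝ, 0 < δ → δ ≤ 1 → ∀ (x : E) (r : ℝ), δ ≤ r →
      μ (Metric.thickening δ S ∩ Metric.ball x r) ≤
        ENNReal.ofReal (C * (r / δ) ^ s * δ ^ Module.finrank ℝ E) := by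
  have := h.isFiniteMeasure
  obtain ⟨C, hC, hup⟩ := h.upper
  obtain ⟨c, hc, hlow⟩ := h.lower
  set n := Module.finrank ℝ E
  set v := μ.real (Metric.ball 0 1)
  refine ⟨2 ^ n * v * C * 3 ^ s / c, fun δ hδ hδ1 x r hr => ?_⟩
  have hr0 : 0 < r := hδ.trans_le hr
  have hvol (y : E) : μ (Metric.closedBall y (2 * δ)) ≤ ENNReal.ofReal ((2 * δ) ^ n * v) := by
    rw [Measure.addHaar_closedBall _ _ (by positivity), ENNReal.ofReal_mul (by positivity),
      ofReal_measureReal measure_ball_lt_top.ne]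
  have hbound := (mul_measure_thickening_inter_ball_le (fun k hk => hlow k hk δ hδ hδ1) hvol hr
    x).trans (mul_le_mul_right (hup x (3 * r) (by positivity)) _)
  have hX : 0 < c * δ ^ s := by positivity
  rw [mul_comm, ← ENNReal.le_div_iff_mul_le (Or.inl (ENNReal.ofReal_pos.2 hX).ne')
    (Or.inl ENNReal.ofReal_ne_top), ← ENNReal.ofReal_mul (by positivity),
    ← ENNReal.ofReal_div_of_pos hX] at hbound
  refine hbound.trans_eq (congrArg ENNReal.ofReal ?_)
  rw [Real.mul_rpow (by norm_num) hr0.le, Real.div_rpow hr0.le hδ.le, mul_pow]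
  have := (Real.rpow_pos_of_pos hδ s).ne'
  field_simp

end VolumeBound

theorem isAhlforsRegular_Icc {ε : ℝ} (hε : 0 < ε) :
    IsAhlforsRegular 1 (Set.Icc 0 ε) (volume.restrict (Set.Icc (0 : ℝ) ε)) := by
  refine ⟨inferInstance, by simp [hε], ⟨2, by norm_num, fun x r _ => ?_⟩,
    ⟨min 1 ε, by positivity, fun x hx r hr hr1 => ?_⟩⟩
  · refine (Measure.restrict_apply_le _ _).trans_eq ?_
    rw [Real.volume_closedBall, Real.rpow_one]
  · have htr : min 1 ε * r ≤ r := mul_le_of_le_one_left hr.le (min_le_left _ _)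
    have htε : min 1 ε * r ≤ ε :=
      (mul_le_of_le_one_right (by positivity) hr1).trans (min_le_right _ _)
    rw [Real.rpow_one, Measure.restrict_apply measurableSet_closedBall, Real.closedBall_eq_Icc,
      Set.Icc_inter_Icc, Real.volume_Icc]
    refine ENNReal.ofReal_le_ofReal (le_sub_iff_add_le.2 (le_min ?_ ?_))
    · rw [← le_sub_iff_add_le']
      exact max_le (by linarith) (by linarith [hx.1])
    · rw [← le_sub_iff_add_le']
      exact max_le (by linarith [hx.2]) (by linarith)

/-! ### Cantor sets -/

section Cantor

variable {ρ : ℝ}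

theorem cantorFunction_nonneg (h0 : 0 ≤ ρ) (ω : ℕ → Bool) : 0 ≤ Cardinal.cantorFunction ρ ω :=
  tsum_nonneg fun _ => Cardinal.cantorFunctionAux_nonneg h0

theorem cantorFunctionAux_le_pow (h0 : 0 ≤ ρ) (ω : ℕ → Bool) (n : ℕ) :
    Cardinal.cantorFunctionAux ρ ω n ≤ ρ ^ n := by
  cases h : ω n
  · rw [Cardinal.cantorFunctionAux_false h]
    positivity
  · rw [Cardinal.cantorFunctionAux_true h]

theorem cantorFunction_le_inv (h0 : 0 ≤ ρ) (h1 : ρ < 1) (ω : ℕ → Bool) :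
    Cardinal.cantorFunction ρ ω ≤ (1 - ρ)⁻¹ :=
  tsum_geometric_of_lt_one h0 h1 ▸ (Cardinal.summable_cantor_function ω h0 h1).tsum_le_tsum
    (cantorFunctionAux_le_pow h0 ω) (summable_geometric_of_lt_one h0 h1)

theorem abs_cantorFunction_sub_le_inv (h0 : 0 ≤ ρ) (h1 : ρ < 1) (ω ω' : ℕ → Bool) :
    |Cardinal.cantorFunction ρ ω' - Cardinal.cantorFunction ρ ω| ≤ (1 - ρ)⁻¹ :=
  abs_sub_le_of_nonneg_of_le (cantorFunction_nonneg h0 ω') (cantorFunction_le_inv h0 h1 ω')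
    (cantorFunction_nonneg h0 ω) (cantorFunction_le_inv h0 h1 ω)

theorem continuous_cantorFunction (h0 : 0 ≤ ρ) (h1 : ρ < 1) :
    Continuous (Cardinal.cantorFunction ρ) := by
  refine continuous_tsum (u := fun n => ρ ^ n) (fun n => ?_) (summable_geometric_of_lt_one h0 h1)
    fun n ω => ?_
  · exact (continuous_of_discreteTopology (f := fun b : Bool => cond b (ρ ^ n) 0)).comp
      (continuous_apply n)
  · rw [Real.norm_of_nonneg (Cardinal.cantorFunctionAux_nonneg h0)]
    exact cantorFunctionAux_le_pow h0 ω n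

theorem abs_cantorFunction_sub_of_eq (h0 : 0 ≤ ρ) (h1 : ρ < 1) {ω ω' : ℕ → Bool}
    (h : ω' 0 = ω 0) :
    |Cardinal.cantorFunction ρ ω' - Cardinal.cantorFunction ρ ω| =
      ρ * |Cardinal.cantorFunction ρ (fun i => ω' (i + 1)) -
        Cardinal.cantorFunction ρ fun i => ω (i + 1)| := by
  rw [Cardinal.cantorFunction_succ ω' h0 h1, Cardinal.cantorFunction_succ ω h0 h1, h,
    add_sub_add_left_eq_sub, ← mul_sub, abs_mul, abs_of_nonneg h0]

theorem le_abs_cantorFunction_sub_of_ne (h0 : 0 ≤ ρ) (h1 : ρ < 1) {ω ω' : ℕ → Bool}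
    (h : ω' 0 ≠ ω 0) :
    1 - ρ * (1 - ρ)⁻¹ ≤ |Cardinal.cantorFunction ρ ω' - Cardinal.cantorFunction ρ ω| := by
  have htail := abs_le.1 (abs_cantorFunction_sub_le_inv h0 h1 (fun i => ω (i + 1))
    fun i => ω' (i + 1))
  have hlower := mul_le_mul_of_nonneg_left htail.1 h0
  have hupper := mul_le_mul_of_nonneg_left htail.2 h0
  rw [Cardinal.cantorFunction_succ ω' h0 h1, Cardinal.cantorFunction_succ ω h0 h1, le_abs]
  cases hω : ω 0 <;> cases hω' : ω' 0
  · exact absurd (hω'.trans hω.symm) h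
  · refine Or.inl ?_
    simp only [cond_false, cond_true]
    linarith
  · refine Or.inr ?_
    simp only [cond_false, cond_true]
    linarith
  · exact absurd (hω'.trans hω.symm) h

theorem abs_cantorFunction_sub_le_of_mem_cylinder (h0 : 0 ≤ ρ) (h1 : ρ < 1) {n : ℕ}
    {ω ω' : ℕ → Bool} (h : ω' ∈ PiNat.cylinder ω n) :
    |Cardinal.cantorFunction ρ ω' - Cardinal.cantorFunction ρ ω| ≤ ρ ^ n * (1 - ρ)⁻¹ := by
  induction n generalizing ω ω' with
  | zero =>
    rw [pow_zero, one_mul]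
    exact abs_cantorFunction_sub_le_inv h0 h1 ω ω'
  | succ n ih =>
    rw [abs_cantorFunction_sub_of_eq h0 h1 (h 0 n.succ_pos), pow_succ', mul_assoc]
    exact mul_le_mul_of_nonneg_left (ih fun i hi => h (i + 1) (Nat.succ_lt_succ hi)) h0

theorem le_abs_cantorFunction_sub_of_notMem_cylinder (h0 : 0 ≤ ρ) (h1 : ρ ≤ 1 / 2) {n : ℕ}
    {ω ω' : ℕ → Bool} (h : ω' ∉ PiNat.cylinder ω (n + 1)) :
    ρ ^ n * (1 - ρ * (1 - ρ)⁻¹) ≤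
      |Cardinal.cantorFunction ρ ω' - Cardinal.cantorFunction ρ ω| := by
  have h1' : ρ < 1 := by linarith
  have hgap : 0 ≤ 1 - ρ * (1 - ρ)⁻¹ := by
    rw [sub_nonneg, ← div_eq_mul_inv, div_le_one (by linarith)]
    linarith
  induction n generalizing ω ω' with
  | zero =>
    rw [pow_zero, one_mul]
    refine le_abs_cantorFunction_sub_of_ne h0 h1' fun heq => h fun i hi => ?_
    rwa [Nat.lt_one_iff.1 hi]
  | succ n ih =>
    rcases eq_or_ne (ω' 0) (ω 0) with heq | hne
    · rw [abs_cantorFunction_sub_of_eq h0 h1' heq, pow_succ', mul_assoc]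
      refine mul_le_mul_of_nonneg_left (ih fun htail => h ?_) h0
      rintro (_ | i) hi
      · exact heq
      · exact htail i (Nat.succ_lt_succ_iff.1 hi)
    · exact (mul_le_of_le_one_left hgap (pow_le_one₀ h0 h1'.le)).trans
        (le_abs_cantorFunction_sub_of_ne h0 h1' hne)

end Cantor

section CoinMeasure

/-- The law of a sequence of independent fair coins: its images under Cantor functions are the
natural measures on self-similar Cantor sets. -/
def coinMeasure : Measure (ℕ → Bool) :=
  Measure.infinitePi fun _ => (PMF.uniformOfFintype Bool).toMeasure

instance : IsProbabilityMeasure coinMeasure := by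
  unfold coinMeasure; infer_instance

theorem coinMeasure_cylinder (ω : ℕ → Bool) (n : ℕ) :
    coinMeasure (PiNat.cylinder ω n) = ENNReal.ofReal ((1 / 2) ^ n) := by
  have h : PiNat.cylinder ω n = Set.pi (Finset.range n : Set ℕ) fun i => {ω i} := by
    ext ω'; simp [PiNat.mem_cylinder_iff, Set.mem_pi]
  rw [h, coinMeasure, Measure.infinitePi_pi _ fun i _ => measurableSet_singleton _]
  simp only [PMF.toMeasure_apply_singleton _ _ (measurableSet_singleton _),
    PMF.uniformOfFintype_apply, Fintype.card_bool, Finset.prod_const, Finset.card_range]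
  rw [ENNReal.ofReal_pow (by norm_num), one_div, ENNReal.ofReal_inv_of_pos (by norm_num)]
  simp

variable {X : Type*} [PseudoMetricSpace X] [MeasurableSpace X] [OpensMeasurableSpace X]
  {φ : (ℕ → Bool) → X} {ρ γ : ℝ}

theorem one_half_pow_eq (hρ : 0 ≤ ρ) (hργ : ρ ^ γ = 1 / 2) (n : ℕ) :
    (1 / 2 : ℝ) ^ n = (ρ ^ n) ^ γ := by
  rw [← hργ, Real.rpow_pow_comm hρ]

theorem map_coinMeasure_closedBall_le (hφ : Measurable φ) (hγ : 0 ≤ γ) (hρ0 : 0 < ρ)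
    (hρ1 : ρ < 1) (hργ : ρ ^ γ = 1 / 2) {c : ℝ} (hc : 0 < c)
    (h : ∀ ⦃n ω ω'⦄, ω' ∉ PiNat.cylinder ω (n + 1) → c * ρ ^ n ≤ dist (φ ω') (φ ω))
    (x : X) {r : ℝ} (hr : 0 < r) :
    coinMeasure.map φ (Metric.closedBall x r) ≤ ENNReal.ofReal ((4 / c * r) ^ γ) := by
  rw [Measure.map_apply hφ measurableSet_closedBall]
  rcases lt_or_ge 1 (4 / c * r) with hbig | hsmall
  · refine prob_le_one.trans ?_
    rw [← ENNReal.ofReal_one]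
    exact ENNReal.ofReal_le_ofReal (Real.one_le_rpow hbig.le hγ)
  obtain ⟨n, hn, hn'⟩ := exists_nat_pow_near_of_lt_one (by positivity : 0 < 4 / c * r) hsmall
    hρ0 hρ1
  rcases (φ ⁻¹' Metric.closedBall x r).eq_empty_or_nonempty with hempty | ⟨ω, hω⟩
  · rw [hempty, measure_empty]
    exact zero_le
  have hsub : φ ⁻¹' Metric.closedBall x r ⊆ PiNat.cylinder ω (n + 1) := fun ω' hω' => by
    by_contra hcyl
    have hdist : dist (φ ω') (φ ω) ≤ r + r :=
      (dist_triangle_right _ _ x).trans (add_le_add hω' hω)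
    have hscale : 4 * r ≤ c * ρ ^ n := by
      calc 4 * r = c * (4 / c * r) := by field_simp
        _ ≤ c * ρ ^ n := by gcongr
    linarith [h hcyl]
  calc coinMeasure (φ ⁻¹' Metric.closedBall x r)
      ≤ ENNReal.ofReal ((1 / 2) ^ (n + 1)) :=
        (measure_mono hsub).trans_eq (coinMeasure_cylinder ω (n + 1))
    _ ≤ ENNReal.ofReal ((4 / c * r) ^ γ) := by
        rw [one_half_pow_eq hρ0.le hργ]
        gcongr

theorem le_map_coinMeasure_closedBall (hφ : Measurable φ) (hγ : 0 ≤ γ) (hρ0 : 0 < ρ)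
    (hρ1 : ρ < 1) (hργ : ρ ^ γ = 1 / 2) {ε : ℝ}
    (h : ∀ ⦃n ω ω'⦄, ω' ∈ PiNat.cylinder ω n → dist (φ ω') (φ ω) ≤ ε * ρ ^ n)
    (ω : ℕ → Bool) {r : ℝ} (hr : 0 < r) (hrε : r ≤ ε) :
    ENNReal.ofReal (1 / 2 * (r / ε) ^ γ) ≤ coinMeasure.map φ (Metric.closedBall (φ ω) r) := by
  have hε : 0 < ε := hr.trans_le hrε
  obtain ⟨n, hn, hn'⟩ := exists_nat_pow_near_of_lt_one (by positivity : 0 < r / ε)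
    ((div_le_one hε).2 hrε) hρ0 hρ1
  have hsub : PiNat.cylinder ω (n + 1) ⊆ φ ⁻¹' Metric.closedBall (φ ω) r := fun ω' hω' =>
    (h hω').trans ((lt_div_iff₀' hε).1 hn).le
  calc ENNReal.ofReal (1 / 2 * (r / ε) ^ γ)
      ≤ ENNReal.ofReal ((1 / 2) ^ (n + 1)) := by
        rw [pow_succ', one_half_pow_eq hρ0.le hργ]
        gcongr
    _ = coinMeasure (PiNat.cylinder ω (n + 1)) := (coinMeasure_cylinder ω (n + 1)).symm
    _ ≤ coinMeasure.map φ (Metric.closedBall (φ ω) r) := by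
        rw [Measure.map_apply hφ measurableSet_closedBall]
        exact measure_mono hsub

theorem isAhlforsRegular_map_coinMeasure (hφ : Measurable φ) (hγ : 0 ≤ γ) (hρ0 : 0 < ρ)
    (hρ1 : ρ < 1) (hργ : ρ ^ γ = 1 / 2) {ε c : ℝ} (hc : 0 < c)
    (hle : ∀ ⦃n ω ω'⦄, ω' ∈ PiNat.cylinder ω n → dist (φ ω') (φ ω) ≤ ε * ρ ^ n)
    (hge : ∀ ⦃n ω ω'⦄, ω' ∉ PiNat.cylinder ω (n + 1) → c * ρ ^ n ≤ dist (φ ω') (φ ω)) :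
    IsAhlforsRegular γ (Set.range φ) (coinMeasure.map φ) := by
  have : IsProbabilityMeasure (coinMeasure.map φ) :=
    Measure.isProbabilityMeasure_map hφ.aemeasurable
  refine ⟨inferInstance, fun hzero => ?_, ⟨(4 / c) ^ γ, by positivity, fun x r hr => ?_⟩,
    ⟨1 / 2 * (max 1 ε)⁻¹ ^ γ, by positivity, ?_⟩⟩
  · have hmass := Measure.le_map_apply (μ := coinMeasure) hφ.aemeasurable (Set.range φ)
    rw [Set.preimage_range, measure_univ, hzero] at hmass
    exact one_ne_zero (nonpos_iff_eq_zero.1 hmass)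
  · rw [← Real.mul_rpow (by positivity) hr.le]
    exact map_coinMeasure_closedBall_le hφ hγ hρ0 hρ1 hργ hc hge x hr
  · rintro _ ⟨ω, rfl⟩ r hr hr1
    rw [mul_assoc, ← Real.mul_rpow (by positivity) hr.le, inv_mul_eq_div]
    refine le_map_coinMeasure_closedBall hφ hγ hρ0 hρ1 hργ (fun n ω ω' h => (hle h).trans ?_) ω hr
      (le_max_of_le_left hr1)
    gcongr
    exact le_max_right _ _

end CoinMeasure

theorem exists_isAhlforsRegular {γ ε : ℝ} (hγ0 : 0 < γ) (hγ1 : γ ≤ 1) (hε : 0 < ε) :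
    ∃ (S : Set ℝ) (ν : Measure ℝ), IsCompact S ∧ S ⊆ Set.Icc 0 ε ∧ IsAhlforsRegular γ S ν := by
  rcases hγ1.eq_or_lt with rfl | hγ1
  · exact ⟨_, _, isCompact_Icc, subset_rfl, isAhlforsRegular_Icc hε⟩
  obtain ⟨ρ, hρ0, hρ2, hργ⟩ : ∃ ρ : ℝ, 0 < ρ ∧ ρ < 1 / 2 ∧ ρ ^ γ = 1 / 2 := by
    refine ⟨(1 / 2) ^ γ⁻¹, by positivity, ?_, Real.rpow_inv_rpow (by norm_num) hγ0.ne'⟩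
    exact Real.rpow_lt_self_of_lt_one (by norm_num) (by norm_num) ((one_lt_inv₀ hγ0).2 hγ1)
  have hρ1 : ρ < 1 := by linarith
  have h1ρ : 0 < 1 - ρ := sub_pos.2 hρ1
  set φ : (ℕ → Bool) → ℝ := fun ω => ε * (1 - ρ) * Cardinal.cantorFunction ρ ω with hφ
  have hφc : Continuous φ := continuous_const.mul (continuous_cantorFunction hρ0.le hρ1)
  have hdist (ω ω' : ℕ → Bool) : dist (φ ω') (φ ω) = ε * (1 - ρ) *
      |Cardinal.cantorFunction ρ ω' - Cardinal.cantorFunction ρ ω| := by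
    rw [hφ, Real.dist_eq, ← mul_sub, abs_mul, abs_of_pos (by positivity)]
  refine ⟨Set.range φ, coinMeasure.map φ, isCompact_range hφc, ?_,
    isAhlforsRegular_map_coinMeasure hφc.measurable hγ0.le hρ0 hρ1 hργ
      (ε := ε) (c := ε * (1 - 2 * ρ)) (mul_pos hε (by linarith)) ?_ ?_⟩
  · rintro _ ⟨ω, rfl⟩
    refine ⟨mul_nonneg (by positivity) (cantorFunction_nonneg hρ0.le ω), ?_⟩
    calc φ ω ≤ ε * (1 - ρ) * (1 - ρ)⁻¹ :=
          mul_le_mul_of_nonneg_left (cantorFunction_le_inv hρ0.le hρ1 ω) (by positivity)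
      _ = ε := by field_simp
  · intro n ω ω' h
    rw [hdist]
    calc _ ≤ ε * (1 - ρ) * (ρ ^ n * (1 - ρ)⁻¹) := by
          gcongr; exact abs_cantorFunction_sub_le_of_mem_cylinder hρ0.le hρ1 h
      _ = _ := by field_simp
  · intro n ω ω' h
    rw [hdist]
    calc ε * (1 - 2 * ρ) * ρ ^ n = ε * (1 - ρ) * (ρ ^ n * (1 - ρ * (1 - ρ)⁻¹)) := by
          field_simp; ring
      _ ≤ _ := by
          gcongr; exact le_abs_cantorFunction_sub_of_notMem_cylinder hρ0.le hρ2.le h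

/-! ### Sharpness -/

/-- The product set `∏ S i` in Euclidean space; sharpness is witnessed by such products. -/
def euclideanPi {ι : Type*} (S : ι → Set ℝ) : Set (EuclideanSpace ℝ ι) :=
  {x | ∀ i, x i ∈ S i}

theorem image_ofLp_euclideanPi {ι : Type*} (S : ι → Set ℝ) :
    WithLp.ofLp '' euclideanPi S = Set.univ.pi S :=
  Set.Subset.antisymm (by rintro _ ⟨x, hx, rfl⟩ i -; exact hx i)
    fun y hy => ⟨WithLp.toLp 2 y, fun i => hy i (Set.mem_univ i), rfl⟩

theorem isCompact_euclideanPi {ι : Type*} {S : ι → Set ℝ} (hS : ∀ i, IsCompact (S i)) :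
    IsCompact (euclideanPi S) := by
  rw [← (PiLp.homeomorph 2 fun _ : ι => ℝ).isCompact_image]
  exact image_ofLp_euclideanPi S ▸ isCompact_univ_pi hS

theorem isDiscreteAlphaSet_euclideanPi {d : ℕ} {S : Fin d → Set ℝ} {γ : Fin d → ℝ}
    {ν : Fin d → Measure ℝ} (h : ∀ i, IsAhlforsRegular (γ i) (S i) (ν i)) :
    IsDiscreteAlphaSet (∑ i, γ i) (euclideanPi S) := by
  obtain ⟨C, hC⟩ := (IsAhlforsRegular.pi h).exists_measure_thickening_inter_ball_le volume
  rw [Module.finrank_fin_fun] at hC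
  refine ⟨C, fun δ h0 h1 x r hr => le_trans ?_ (hC δ h0 h1 x.ofLp r hr)⟩
  have hdist (y z : EuclideanSpace ℝ (Fin d)) : dist y.ofLp z.ofLp ≤ dist y z := by
    simpa using (PiLp.lipschitzWith_ofLp 2 (fun _ : Fin d => ℝ)).dist_le_mul y z
  rw [← (PiLp.volume_preserving_ofLp (Fin d)).measure_preimage
    (Metric.isOpen_thickening.measurableSet.inter measurableSet_ball).nullMeasurableSet]
  refine measure_mono fun y hy => ⟨?_, (hdist y x).trans_lt hy.2⟩
  obtain ⟨z, hz, hyz⟩ := Metric.mem_thickening_iff.1 hy.1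
  exact Metric.mem_thickening_iff.2 ⟨z.ofLp, fun i _ => hz i, (hdist y z).trans_lt hyz⟩

theorem isRegularSet_euclideanPi {d : ℕ} {S : Fin d → Set ℝ} {γ : Fin d → ℝ}
    {ν : Fin d → Measure ℝ} (hS : ∀ i, IsCompact (S i))
    (h : ∀ i, IsAhlforsRegular (γ i) (S i) (ν i)) (hγ : 0 ≤ ∑ i, γ i) :
    IsRegularSet (∑ i, γ i) (euclideanPi S) := by
  have hcomp := isCompact_euclideanPi hS
  have hdisc := isDiscreteAlphaSet_euclideanPi h
  refine ⟨hcomp, le_antisymm ?_ ?_, hdisc⟩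
  · exact dimH_le_of_upperMinkowskiDim_le hγ (hdisc.upperMinkowskiDim_le hcomp.isBounded)
  · calc ENNReal.ofReal (∑ i, γ i) ≤ dimH (Set.univ.pi S) := (IsAhlforsRegular.pi h).le_dimH hγ
      _ = dimH (WithLp.ofLp '' euclideanPi S) := by rw [image_ofLp_euclideanPi]
      _ ≤ dimH (euclideanPi S) := (PiLp.lipschitzWith_ofLp 2 _).dimH_image_le _

section UnitPairs

variable {n : ℕ}

/-- The coordinates of a pair of points, except the first coordinate of the second point, which
the unit distance condition determines up to finitely many choices. -/
def pairCoords (p : EuclideanSpace ℝ (Fin (n + 1)) × EuclideanSpace ℝ (Fin (n + 1))) :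
    Fin (n + 1) ⊕ Fin n → ℝ :=
  Sum.elim p.1 (Fin.tail p.2)

theorem lipschitzWith_pairCoords : LipschitzWith 1 (pairCoords (n := n)) := by
  refine LipschitzWith.of_dist_le_mul fun p q => ?_
  rw [NNReal.coe_one, one_mul]
  have hcoord (x y : EuclideanSpace ℝ (Fin (n + 1))) (i) : dist (x i) (y i) ≤ dist x y := by
    rw [dist_eq_norm, dist_eq_norm]
    exact PiLp.norm_apply_le (x - y) i
  refine (dist_pi_le_iff dist_nonneg).2 fun i => ?_
  rw [Prod.dist_eq]
  rcases i with i | i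
  · exact (hcoord p.1 q.1 i).trans (le_max_left _ _)
  · exact (hcoord p.2 q.2 i.succ).trans (le_max_right _ _)

theorem sum_sq_sub_le_one {u v : Fin n → ℝ} (hu : ∀ i, u i ∈ Set.Icc 0 (1 / ((n : ℝ) + 1)))
    (hv : ∀ i, v i ∈ Set.Icc 0 (1 / ((n : ℝ) + 1))) : ∑ i, (v i - u i) ^ 2 ≤ 1 := by
  have hinv : 1 / ((n : ℝ) + 1) ≤ 1 := by
    rw [div_le_one (by positivity)]
    linarith [n.cast_nonneg (α := ℝ)]
  have hterm (i : Fin n) : (v i - u i) ^ 2 ≤ 1 / ((n : ℝ) + 1) := by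
    have habs : |v i - u i| ≤ 1 / ((n : ℝ) + 1) :=
      abs_sub_le_of_nonneg_of_le (hv i).1 (hv i).2 (hu i).1 (hu i).2
    rw [← sq_abs]
    exact (pow_le_of_le_one (abs_nonneg _) (habs.trans hinv) two_ne_zero).trans habs
  calc ∑ i, (v i - u i) ^ 2 ≤ ∑ _i : Fin n, 1 / ((n : ℝ) + 1) :=
        Finset.sum_le_sum fun i _ => hterm i
    _ = n / ((n : ℝ) + 1) := by
        rw [Finset.sum_const, Finset.card_univ, Fintype.card_fin, nsmul_eq_mul, mul_one_div]
    _ ≤ 1 := by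
        rw [div_le_one (by positivity)]
        linarith

variable {T : Set ℝ}

theorem pi_subset_pairCoords_image_unitPairs (hT : T ⊆ Set.Icc 0 (1 / ((n : ℝ) + 1))) :
    Set.univ.pi (Sum.elim (Fin.cons (Set.Icc 0 1) fun _ => T) (fun _ : Fin n => T)) ⊆
      pairCoords '' unitPairs (euclideanPi (Fin.cons (Set.Icc 0 2) fun _ : Fin n => T)) := by
  intro z hz
  have hz0 : z (Sum.inl 0) ∈ Set.Icc (0 : ℝ) 1 := hz (Sum.inl 0) (Set.mem_univ _)
  have hz1 (i : Fin n) : z (Sum.inl i.succ) ∈ T := hz (Sum.inl i.succ) (Set.mem_univ _)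
  have hz2 (i : Fin n) : z (Sum.inr i) ∈ T := hz (Sum.inr i) (Set.mem_univ _)
  have hQ0 : 0 ≤ ∑ i : Fin n, (z (Sum.inr i) - z (Sum.inl i.succ)) ^ 2 :=
    Finset.sum_nonneg fun i _ => sq_nonneg _
  have hQ1 := sum_sq_sub_le_one (fun i => hT (hz1 i)) fun i => hT (hz2 i)
  set Q := ∑ i : Fin n, (z (Sum.inr i) - z (Sum.inl i.succ)) ^ 2 with hQ
  have ht1 : √(1 - Q) ≤ 1 := Real.sqrt_le_one.2 (by linarith)
  refine ⟨(WithLp.toLp 2 fun i => z (Sum.inl i),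
    WithLp.toLp 2 (Fin.cons (z (Sum.inl 0) + √(1 - Q)) fun i => z (Sum.inr i))),
    ⟨Fin.forall_fin_succ.2 ⟨⟨hz0.1, hz0.2.trans one_le_two⟩, hz1⟩,
      Fin.forall_fin_succ.2 ⟨⟨add_nonneg hz0.1 (Real.sqrt_nonneg _), ?_⟩, hz2⟩, ?_⟩, ?_⟩
  · exact (add_le_add hz0.2 ht1).trans_eq one_add_one_eq_two
  · rw [← sq_eq_sq₀ (norm_nonneg _) zero_le_one, EuclideanSpace.norm_sq_eq, Fin.sum_univ_succ]
    simp only [PiLp.sub_apply, Fin.cons_zero, Fin.cons_succ, Real.norm_eq_abs, sq_abs]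
    rw [add_sub_cancel_left, Real.sq_sqrt (by linarith), ← hQ, sub_add_cancel, one_pow]
  · funext i
    rcases i with i | i <;> rfl

variable {ν : Measure ℝ} {γ : ℝ}

theorem isRegularSet_euclideanPi_cons_Icc (n : ℕ) (hγ : 0 ≤ γ) (hTc : IsCompact T)
    (hT : IsAhlforsRegular γ T ν) :
    IsRegularSet (1 + n * γ) (euclideanPi (Fin.cons (Set.Icc 0 2) fun _ : Fin n => T)) := by
  have hsum : ∑ i, (Fin.cons 1 fun _ => γ : Fin (n + 1) → ℝ) i = 1 + n * γ := by
    simp [Fin.sum_univ_succ]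
  rw [← hsum]
  refine isRegularSet_euclideanPi
    (ν := Fin.cons (volume.restrict (Set.Icc 0 2)) fun _ => ν)
    (Fin.forall_fin_succ.2 ⟨isCompact_Icc, fun _ => hTc⟩)
    (Fin.forall_fin_succ.2 ⟨isAhlforsRegular_Icc two_pos, fun _ => hT⟩) ?_
  rw [hsum]
  positivity

theorem le_dimH_unitPairs_euclideanPi (hγ : 0 ≤ γ) (hTsub : T ⊆ Set.Icc 0 (1 / ((n : ℝ) + 1)))
    (hT : IsAhlforsRegular γ T ν) :
    ENNReal.ofReal (1 + 2 * n * γ) ≤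
      dimH (unitPairs (euclideanPi (Fin.cons (Set.Icc 0 2) fun _ : Fin n => T))) := by
  have hsum : ∑ i, (Sum.elim (Fin.cons 1 fun _ => γ) fun _ => γ : Fin (n + 1) ⊕ Fin n → ℝ) i =
      1 + 2 * n * γ := by
    simp only [Fintype.sum_sum_type, Sum.elim_inl, Sum.elim_inr, Fin.sum_univ_succ, Fin.cons_zero,
      Fin.cons_succ, Finset.sum_const, Finset.card_univ, Fintype.card_fin, nsmul_eq_mul]
    ring
  have hpi := IsAhlforsRegular.pi (ι := Fin (n + 1) ⊕ Fin n)
    (γ := Sum.elim (Fin.cons 1 fun _ => γ) fun _ => γ)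
    (S := Sum.elim (Fin.cons (Set.Icc 0 1) fun _ => T) fun _ => T)
    (ν := Sum.elim (Fin.cons (volume.restrict (Set.Icc 0 1)) fun _ => ν) fun _ => ν)
    (Sum.forall.2 ⟨Fin.forall_fin_succ.2 ⟨isAhlforsRegular_Icc one_pos, fun _ => hT⟩,
      fun _ => hT⟩)
  rw [hsum] at hpi
  calc ENNReal.ofReal (1 + 2 * n * γ) ≤ _ := hpi.le_dimH (by positivity)
    _ ≤ _ := dimH_mono (pi_subset_pairCoords_image_unitPairs hTsub)
    _ ≤ _ := lipschitzWith_pairCoords.dimH_image_le _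

end UnitPairs

theorem le_g {d : ℕ} (hd : 1 ≤ d) {α : ℝ} (h1 : ((d : ℝ) + 1) / 2 ≤ α) (h2 : α ≤ d) :
    ENNReal.ofReal (2 * α - 1) ≤ g d α := by
  obtain ⟨n, rfl⟩ := Nat.exists_eq_add_of_le' hd
  push_cast at h1 h2
  obtain ⟨γ, hγ0, hγ1, rfl⟩ : ∃ γ : ℝ, 0 < γ ∧ γ ≤ 1 ∧ α = 1 + n * γ := by
    rcases n.eq_zero_or_pos with rfl | hn
    · refine ⟨1, one_pos, le_rfl, ?_⟩
      norm_num at h1 h2 ⊢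
      linarith
    · have hn' : (0 : ℝ) < n := Nat.cast_pos.2 hn
      refine ⟨(α - 1) / n, div_pos (by linarith) hn', (div_le_one hn').2 (by linarith), ?_⟩
      field_simp
      ring
  obtain ⟨T, ν, hTc, hTsub, hT⟩ := exists_isAhlforsRegular hγ0 hγ1
    (by positivity : (0 : ℝ) < 1 / ((n : ℝ) + 1))
  calc ENNReal.ofReal (2 * (1 + n * γ) - 1) = ENNReal.ofReal (1 + 2 * n * γ) := by
        congr 1; ring
    _ ≤ dimH (unitPairs (euclideanPi (Fin.cons (Set.Icc 0 2) fun _ : Fin n => T))) :=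
        le_dimH_unitPairs_euclideanPi hγ0.le hTsub hT
    _ ≤ g (n + 1) (1 + n * γ) :=
        le_sSup ⟨_, isRegularSet_euclideanPi_cons_Icc n hγ0.le hTc hT, rfl⟩

end UnitDistance

end

theorem theorem2 (d : ℕ) (hd : 1 ≤ d) (α : ℝ) (hα : 0 ≤ α) :
    (((d : ℝ) + 1) / 2 ≤ α → α ≤ d →
      UnitDistance.g d α = ENNReal.ofReal (2 * α - 1) ∧
      ∀ K : Set (EuclideanSpace ℝ (Fin d)), UnitDistance.IsRegularSet α K →
        UnitDistance.upperMinkowskiDim (UnitDistance.unitPairs K) ≤ ((2 * α - 1 : ℝ) : EReal)) ∧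
    (α ≤ ((d : ℝ) + 1) / 2 →
      UnitDistance.g d α ≤ ENNReal.ofReal (α + ((d : ℝ) - 1) / 2) ∧
      ∀ K : Set (EuclideanSpace ℝ (Fin d)), UnitDistance.IsRegularSet α K →
        UnitDistance.upperMinkowskiDim (UnitDistance.unitPairs K) ≤
          ((α + ((d : ℝ) - 1) / 2 : ℝ) : EReal)) := by
  have : (1 : ℝ) ≤ d := Nat.one_le_cast.2 hd
  have hg := UnitDistance.g_le hd hα
  have hM : ∀ K : Set (EuclideanSpace ℝ (Fin d)), UnitDistance.IsRegularSet α K →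
      UnitDistance.upperMinkowskiDim (UnitDistance.unitPairs K) ≤
        ((max (2 * α - 1) (α + ((d : ℝ) - 1) / 2) : ℝ) : EReal) := fun _ hK =>
    hK.isDiscreteAlphaSet.upperMinkowskiDim_unitPairs_le hd hK.isCompact.isBounded
  constructor
  · intro h1 h2
    rw [max_eq_left (by linarith)] at hg
    simp only [max_eq_left (by linarith : α + ((d : ℝ) - 1) / 2 ≤ 2 * α - 1)] at hM
    exact ⟨le_antisymm hg (UnitDistance.le_g hd h1 h2), hM⟩
  · intro h
    rw [max_eq_right (by linarith)] at hg
    simp only [max_eq_right (by linarith : 2 * α - 1 ≤ α + ((d : ℝ) - 1) / 2)] at hM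
    exact ⟨hg, hM⟩
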